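/- Let $G$ be a real Lie group of dimension 6 with Lie algebra $\mathfrak g$, let $g$ be a left-invariant Riemannian metric on $G$ and $J$ a left-invariant $g$-orthogonal almost complex structure, with fundamental 2-form $\omega(X,Y)=g(JX,Y)$ and Levi-Civita connection $\nabla$. Put $$\mathcal W=\{T\in\mathfrak g^*\otimes\textstyle\bigwedge^2\mathfrak g^*: T(X,JY,JZ)=-T(X,Y,Z)\},$$ which contains $\nabla\omega$, and let $\mathcal W=\mathcal W_1\oplus\mathcal W_2\oplus\mathcal W_3\oplus\mathcal W_4$ be the Gray–Hervella decomposition. Here $\mathcal W_1$ consists of the totally skew tensors in $\mathcal W$; $\mathcal W_2$ of those whose cyclic sum over $X,Y,Z$ vanishes; and $\mathcal W_4$ of those of the form $$T(X,Y,Z)=g(X,Y)\theta(Z)-g(X,Z)\theta(Y)-g(X,JY)\theta(JZ)+g(X,JZ)\theta(JY),\qquad \theta\in\mathfrak g^*.$$ The class $\mathcal Z_{124}$ is the set of those $J$ with $\nabla\omega\in\mathcal W_1\oplus\mathcal W_2\oplus\mathcal W_4$ (that is, $W_3=0$). Let $(\alpha,\beta,\gamma)$ be a basis of the left-invariant $(1,0)$-forms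 such that $\omega=\frac i2(\alpha\wedge\bar\alpha+\beta\wedge\bar\beta+\gamma\wedge\bar\gamma)$. Omitting wedge signs, set $$\eta_1=\alpha\beta\bar\gamma,\quad \eta_2=\beta\gamma\bar\alpha,\quad \eta_3=\alpha\gamma\bar\beta,\quad \eta_4=\alpha\beta\bar\beta-\alpha\gamma\bar\gamma,\quad \eta_5=\beta\alpha\bar\alpha-\beta\gamma\bar\gamma,\quad \eta_6=\gamma\alpha\bar\alpha-\gamma\beta\bar\beta.$$ Then $J\in\mathcal Z_{124}$ if and only if $(d\omega)\wedge\eta_i=0$ for $1\le i\le 6$. Moreover, $(\eta_1,\dots,\eta_6)$ is a basis of the space $\bigwedge^{2,1}_0$ of left-invariant effective $(2,1)$-forms, i.e. the left-invariant $(2,1)$-forms $\varphi$ with $\omega\wedge\varphi=0$. The forms $(d\omega)\wedge\eta_i$ represent the effective components of $d\omega$: there are $c_1,\dots,c_6\in\mathbb C$ and $\rho\in\bigwedge^{3,0}+\bigwedge^{0,3}+\omega\wedge\bigwedge^1$ (complex left-invariant forms) with $$d\omega=\rho+\sum_{i=1}^6\left(c_i\bar\eta_i+\bar c_i\eta_i\right),$$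 and, for every $i$, $(d\omega)\wedge\eta_i=c_i\,\bar\eta_i\wedge\eta_i$ with $\bar\eta_i\wedge\eta_i\neq0$. -/

import Mathlib

noncomputable section

namespace AlmostHermitian

/-! ### Invariant forms -/

/-- Complex-valued alternating `k`-forms on `L`. For the Lie algebra `L` of a Lie group `G` these
are the complex left-invariant `k`-forms on `G`. -/
abbrev Form (L : Type*) [AddCommGroup L] [Module ℝ L] (k : ℕ) : Type _ := L [⋀^Fin k]→ₗ[ℝ] ℂ

section Forms

variable {L : Type*} [AddCommGroup L] [Module ℝ L]

/-- The wedge product, normalised by `(a ∧ b)(X, Y) = a(X) b(Y) - a(Y) b(X)` on 1-forms. -/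
def wedge {k l : ℕ} (a : Form L k) (b : Form L l) : Form L (k + l) :=
  ((LinearMap.mul' ℝ ℂ).compAlternatingMap (a.domCoprod b)).domDomCongr finSumFinEquiv

/-- Complex conjugation of forms. -/
def conjForm {k : ℕ} (a : Form L k) : Form L k :=
  Complex.conjAe.toLinearMap.compAlternatingMap a

end Forms

infixl:70 " ⋏ " => AlmostHermitian.wedge

/-- The exterior derivative of an invariant 2-form on a Lie group with Lie algebra `L`. -/
def extDeriv₂ {L : Type*} [LieRing L] [LieAlgebra ℝ L] (φ : Form L 2) : Form L 3 where
  toFun v := -φ ![⁅v 0, v 1⁆, v 2] + φ ![⁅v 0, v 2⁆, v 1] - φ ![⁅v 1, v 2⁆, v 0]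
  map_update_add' := by
    intro inst v i x y
    have h0 : ∀ a b c : L, φ ![a + b, c] = φ ![a, c] + φ ![b, c] := fun a b c ↦ by
      simpa using φ.map_vecCons_add ![c] a b
    have h1 : ∀ a b c : L, φ ![c, a + b] = φ ![c, a] + φ ![c, b] := fun a b c ↦ by
      have h : ∀ p q : L, φ ![p, q] = -φ ![q, p] := fun p q ↦ by
        have := φ.map_swap ![q, p] (i := 0) (j := 1) (by decide)
        rw [← this]
        congr 1
        ext j
        fin_cases j <;> simp
      rw [h, h0, h a, h b]; ring
    obtain rfl := Subsingleton.elim inst (instDecidableEqFin 3)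
    fin_cases i <;> simp [Function.update, h0, h1] <;> ring
  map_update_smul' := by
    intro inst v i t x
    have h0 : ∀ a c : L, φ ![t • a, c] = t * φ ![a, c] := fun a c ↦ by
      simpa using φ.map_vecCons_smul ![c] t a
    have h1 : ∀ a c : L, φ ![c, t • a] = t * φ ![c, a] := fun a c ↦ by
      have h : ∀ p q : L, φ ![p, q] = -φ ![q, p] := fun p q ↦ by
        have := φ.map_swap ![q, p] (i := 0) (j := 1) (by decide)
        rw [← this]
        congr 1
        ext j
        fin_cases j <;> simp
      rw [h, h0, h a]; ring
    obtain rfl := Subsingleton.elim inst (instDecidableEqFin 3)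
    fin_cases i <;> simp [Function.update, h0, h1] <;> ring
  map_eq_zero_of_eq' := by
    intro v i j hv hij
    have h : ∀ p q : L, φ ![p, q] = -φ ![q, p] := fun p q ↦ by
      have := φ.map_swap ![q, p] (i := 0) (j := 1) (by decide)
      rw [← this]
      congr 1
      ext j
      fin_cases j <;> simp
    have hz : ∀ p : L, φ ![0, p] = 0 := fun p ↦ φ.map_coord_zero 0 (by simp)
    have hn : ∀ p q : L, φ ![-p, q] = -φ ![p, q] := fun p q ↦ by
      have := φ.map_vecCons_smul ![q] (-1) p
      simpa using this
    fin_cases i <;> fin_cases j <;> simp at hij hv <;> simp [hv, hz]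
    · rw [← lie_skew (v 2) (v 1), hn]; ring
    · rw [← lie_skew (v 0) (v 1), hn]; ring

/-! ### Invariant metrics and their Levi-Civita connection -/

/-- A (left-invariant Riemannian) metric: a positive definite symmetric bilinear form on `L`. -/
structure InvariantMetric (L : Type*) [AddCommGroup L] [Module ℝ L] where
  form : LinearMap.BilinForm ℝ L
  symm : ∀ X Y, form X Y = form Y X
  pos : ∀ X, X ≠ 0 → 0 < form X X

theorem InvariantMetric.nondegenerate {L : Type*} [AddCommGroup L] [Module ℝ L]
    (g : InvariantMetric L) : g.form.Nondegenerate := by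
  refine ⟨fun X h ↦ ?_, fun X h ↦ ?_⟩ <;>
  · by_contra hX
    exact (g.pos X hX).ne' (h X)

section LeviCivita

variable {L : Type*} [LieRing L] [LieAlgebra ℝ L]

/-- The right-hand side of the Koszul formula for left-invariant vector fields. -/
def koszul (g : InvariantMetric L) (X Y : L) : Module.Dual ℝ L where
  toFun Z := (1 / 2 : ℝ) * (g.form ⁅X, Y⁆ Z - g.form ⁅Y, Z⁆ X + g.form ⁅Z, X⁆ Y)
  map_add' := by intros; simp; ring
  map_smul' := by intros; simp; ring

/-- The Levi-Civita connection `∇_X Y` of `g` on left-invariant vector fields. -/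
def leviCivita [FiniteDimensional ℝ L] (g : InvariantMetric L) : L →ₗ[ℝ] L →ₗ[ℝ] L :=
  LinearMap.mk₂ ℝ (fun X Y ↦ (g.form.toDual g.nondegenerate).symm (koszul g X Y))
    (fun X X' Y ↦ by
      rw [← map_add]; congr 1; ext Z; simp [koszul]; ring)
    (fun c X Y ↦ by
      rw [← map_smul]; congr 1; ext Z; simp [koszul]; ring)
    (fun X Y Y' ↦ by
      rw [← map_add]; congr 1; ext Z; simp [koszul]; ring)
    (fun c X Y ↦ by
      rw [← map_smul]; congr 1; ext Z; simp [koszul]; ring)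

variable [FiniteDimensional ℝ L]

theorem leviCivita_koszul (g : InvariantMetric L) (X Y Z : L) :
    g.form (leviCivita g X Y) Z =
      (1 / 2 : ℝ) * (g.form ⁅X, Y⁆ Z - g.form ⁅Y, Z⁆ X + g.form ⁅Z, X⁆ Y) := by
  simp only [leviCivita, LinearMap.mk₂_apply]
  rw [LinearMap.BilinForm.apply_toDual_symm_apply]
  rfl

/-- The connection is metric. -/
theorem leviCivita_metric (g : InvariantMetric L) (X Y Z : L) :
    g.form (leviCivita g X Y) Z + g.form Y (leviCivita g X Z) = 0 := by
  have h1 : ⁅Z, Y⁆ = -⁅Y, Z⁆ := (lie_skew _ _).symm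
  have h2 : ⁅Y, X⁆ = -⁅X, Y⁆ := (lie_skew _ _).symm
  have h3 : ⁅Z, X⁆ = -⁅X, Z⁆ := (lie_skew _ _).symm
  rw [g.symm Y, leviCivita_koszul, leviCivita_koszul, h1, h2, h3]
  simp only [map_neg, LinearMap.neg_apply]; ring

/-- The connection is torsion-free. -/
theorem leviCivita_torsionFree (g : InvariantMetric L) (X Y : L) :
    leviCivita g X Y - leviCivita g Y X = ⁅X, Y⁆ := by
  rw [← sub_eq_zero]
  refine g.nondegenerate.1 _ fun Z ↦ ?_
  simp only [map_sub, LinearMap.sub_apply, leviCivita_koszul]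
  have h1 : ⁅Z, Y⁆ = -⁅Y, Z⁆ := (lie_skew _ _).symm
  have h2 : ⁅Y, X⁆ = -⁅X, Y⁆ := (lie_skew _ _).symm
  have h3 : ⁅Z, X⁆ = -⁅X, Z⁆ := (lie_skew _ _).symm
  rw [h1, h2, h3]
  simp only [map_neg, LinearMap.neg_apply]; ring

end LeviCivita

/-! ### Almost Hermitian structures -/

/-- A `g`-orthogonal (left-invariant) almost complex structure. -/
structure OrthogonalACS {L : Type*} [AddCommGroup L] [Module ℝ L] (g : InvariantMetric L) where
  map : L →ₗ[ℝ] L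
  sq : ∀ X, map (map X) = -X
  orth : ∀ X Y, g.form (map X) (map Y) = g.form X Y

section Hermitian

variable {L : Type*} [AddCommGroup L] [Module ℝ L] {g : InvariantMetric L}

/-- The fundamental 2-form `ω(X, Y) = g(JX, Y)`. -/
def fundamentalForm (J : OrthogonalACS g) : Form L 2 where
  toFun v := (g.form (J.map (v 0)) (v 1) : ℂ)
  map_update_add' := by
    intro inst v i x y
    obtain rfl := Subsingleton.elim inst (instDecidableEqFin 2)
    fin_cases i <;> simp [Function.update]
  map_update_smul' := by
    intro inst v i t x
    obtain rfl := Subsingleton.elim inst (instDecidableEqFin 2)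
    fin_cases i <;> simp [Function.update]
  map_eq_zero_of_eq' := by
    have h : ∀ X : L, g.form (J.map X) X = 0 := fun X ↦ by
      have h1 := J.orth X (J.map X)
      rw [J.sq, map_neg, g.symm X] at h1
      linarith
    intro v i j hv hij
    fin_cases i <;> fin_cases j <;> simp at hij hv <;> simp [hv, h]

/-- `(1,0)`-forms: the `i`-eigenspace of `J` on complex 1-forms. -/
def IsOneZero (J : OrthogonalACS g) (a : Form L 1) : Prop :=
  ∀ X, a ![J.map X] = Complex.I * a ![X]

/-- `(α, β, γ)` are `(1,0)`-forms with `ω = (i/2)(α ∧ ᾱ + β ∧ β̄ + γ ∧ γ̄)`. In real dimension 6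
they then form a basis of the `(1,0)`-forms, since `ω` is nondegenerate. -/
structure IsUnitaryCoframe (J : OrthogonalACS g) (α β γ : Form L 1) : Prop where
  left : IsOneZero J α
  mid : IsOneZero J β
  right : IsOneZero J γ
  fundamental : fundamentalForm J =
    (Complex.I / 2) • (α ⋏ conjForm α + β ⋏ conjForm β + γ ⋏ conjForm γ)

/-- Forms of type `(2,1)`. -/
def lambda21 (J : OrthogonalACS g) : Submodule ℂ (Form L 3) :=
  Submodule.span ℂ {φ | ∃ a b c : Form L 1, IsOneZero J a ∧ IsOneZero J b ∧ IsOneZero J c ∧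
    φ = a ⋏ b ⋏ conjForm c}

/-- Forms of type `(3,0)`. -/
def lambda30 (J : OrthogonalACS g) : Submodule ℂ (Form L 3) :=
  Submodule.span ℂ {φ | ∃ a b c : Form L 1, IsOneZero J a ∧ IsOneZero J b ∧ IsOneZero J c ∧
    φ = a ⋏ b ⋏ c}

/-- Forms of type `(0,3)`. -/
def lambda03 (J : OrthogonalACS g) : Submodule ℂ (Form L 3) :=
  Submodule.span ℂ {φ | ∃ a b c : Form L 1, IsOneZero J a ∧ IsOneZero J b ∧ IsOneZero J c ∧
    φ = conjForm a ⋏ conjForm b ⋏ conjForm c}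

/-- The image of the complex 1-forms under wedging with `ω`. -/
def omegaWedge (J : OrthogonalACS g) : Submodule ℂ (Form L 3) :=
  Submodule.span ℂ {φ | ∃ a : Form L 1, φ = fundamentalForm J ⋏ a}

/-- Effective (primitive) `(2,1)`-forms in real dimension 6: those annihilated by wedging with
`ω`. -/
def IsEffective21 (J : OrthogonalACS g) (φ : Form L 3) : Prop :=
  φ ∈ lambda21 J ∧ fundamentalForm J ⋏ φ = 0

/-- The six 3-forms of the statement. -/
def eta (α β γ : Form L 1) : Fin 6 → Form L 3 :=
  ![α ⋏ β ⋏ conjForm γ,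
    β ⋏ γ ⋏ conjForm α,
    α ⋏ γ ⋏ conjForm β,
    α ⋏ β ⋏ conjForm β - α ⋏ γ ⋏ conjForm γ,
    β ⋏ α ⋏ conjForm α - β ⋏ γ ⋏ conjForm γ,
    γ ⋏ α ⋏ conjForm α - γ ⋏ β ⋏ conjForm β]

/-! ### The Gray–Hervella decomposition -/

/-- Real trilinear tensors on `L`. -/
abbrev Tensor₃ (L : Type*) [AddCommGroup L] [Module ℝ L] : Type _ :=
  L →ₗ[ℝ] L →ₗ[ℝ] L →ₗ[ℝ] ℝ

/-- The space `W` of tensors with the symmetries of `∇ω`. -/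
def grayHervellaSpace (J : OrthogonalACS g) : Submodule ℝ (Tensor₃ L) where
  carrier := {T | (∀ X Y Z, T X Y Z = -T X Z Y) ∧
    ∀ X Y Z, T X (J.map Y) (J.map Z) = -T X Y Z}
  zero_mem' := by simp
  add_mem' := by
    rintro S T ⟨hS, hS'⟩ ⟨hT, hT'⟩
    refine ⟨fun X Y Z ↦ ?_, fun X Y Z ↦ ?_⟩
    · have h1 := hS X Y Z
      have h2 := hT X Y Z
      simp only [LinearMap.add_apply]; linarith
    · simp only [LinearMap.add_apply, hS', hT']; ring
  smul_mem' := by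
    rintro c T ⟨hT, hT'⟩
    refine ⟨fun X Y Z ↦ ?_, fun X Y Z ↦ ?_⟩
    · have h2 := hT X Y Z
      simp only [LinearMap.smul_apply, smul_eq_mul, h2]; ring
    · simp only [LinearMap.smul_apply, smul_eq_mul, hT']; ring

/-- `W₁`: the totally skew tensors in `W`. -/
def W₁ (J : OrthogonalACS g) : Submodule ℝ (Tensor₃ L) where
  carrier := {T | T ∈ grayHervellaSpace J ∧ ∀ X Z, T X X Z = 0}
  zero_mem' := ⟨Submodule.zero_mem _, by simp⟩
  add_mem' := by
    rintro S T ⟨hS, hS'⟩ ⟨hT, hT'⟩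
    exact ⟨Submodule.add_mem _ hS hT, fun X Z ↦ by simp [hS', hT']⟩
  smul_mem' := by
    rintro c T ⟨hT, hT'⟩
    exact ⟨Submodule.smul_mem _ c hT, fun X Z ↦ by simp [hT']⟩

/-- `W₂`: the tensors in `W` whose cyclic sum vanishes. -/
def W₂ (J : OrthogonalACS g) : Submodule ℝ (Tensor₃ L) where
  carrier := {T | T ∈ grayHervellaSpace J ∧ ∀ X Y Z, T X Y Z + T Y Z X + T Z X Y = 0}
  zero_mem' := ⟨Submodule.zero_mem _, by simp⟩
  add_mem' := by
    rintro S T ⟨hS, hS'⟩ ⟨hT, hT'⟩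
    refine ⟨Submodule.add_mem _ hS hT, fun X Y Z ↦ ?_⟩
    have h1 := hS' X Y Z
    have h2 := hT' X Y Z
    simp only [LinearMap.add_apply]; linarith
  smul_mem' := by
    rintro c T ⟨hT, hT'⟩
    refine ⟨Submodule.smul_mem _ c hT, fun X Y Z ↦ ?_⟩
    have h2 := hT' X Y Z
    simp only [LinearMap.smul_apply, smul_eq_mul, ← mul_add, h2, mul_zero]

/-- `W₄`: the copy of the 1-forms in `W`. -/
def W₄ (J : OrthogonalACS g) : Submodule ℝ (Tensor₃ L) where
  carrier := {T | T ∈ grayHervellaSpace J ∧ ∃ θ : Module.Dual ℝ L, ∀ X Y Z,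
    T X Y Z = g.form X Y * θ Z - g.form X Z * θ Y
      - g.form X (J.map Y) * θ (J.map Z) + g.form X (J.map Z) * θ (J.map Y)}
  zero_mem' := ⟨Submodule.zero_mem _, 0, by simp⟩
  add_mem' := by
    rintro S T ⟨hS, θ, hS'⟩ ⟨hT, τ, hT'⟩
    refine ⟨Submodule.add_mem _ hS hT, θ + τ, fun X Y Z ↦ ?_⟩
    simp only [LinearMap.add_apply, hS', hT']; ring
  smul_mem' := by
    rintro c T ⟨hT, θ, hT'⟩
    refine ⟨Submodule.smul_mem _ c hT, c • θ, fun X Y Z ↦ ?_⟩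
    simp only [LinearMap.smul_apply, smul_eq_mul, hT']; ring

end Hermitian

/-- The covariant derivative `(X, Y, Z) ↦ (∇_X ω)(Y, Z)` of the fundamental 2-form; the term
`X(ω(Y, Z))` vanishes on left-invariant fields. -/
def nablaOmega {L : Type*} [LieRing L] [LieAlgebra ℝ L] [FiniteDimensional ℝ L]
    {g : InvariantMetric L} (J : OrthogonalACS g) : Tensor₃ L :=
  LinearMap.mk₂ ℝ
    (fun X Y ↦ -(g.form (J.map (leviCivita g X Y))) - (g.form (J.map Y)).comp (leviCivita g X))
    (fun X X' Y ↦ by ext Z; simp; ring)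
    (fun c X Y ↦ by ext Z; simp; ring)
    (fun X Y Y' ↦ by ext Z; simp; ring)
    (fun c X Y ↦ by ext Z; simp; ring)

theorem nablaOmega_apply {L : Type*} [LieRing L] [LieAlgebra ℝ L] [FiniteDimensional ℝ L]
    {g : InvariantMetric L} (J : OrthogonalACS g) (X Y Z : L) :
    nablaOmega J X Y Z =
      -g.form (J.map (leviCivita g X Y)) Z - g.form (J.map Y) (leviCivita g X Z) := rfl

/-- The class of the `J` for which `∇ω` lies in `W₁ ⊕ W₂ ⊕ W₄`. -/
def Z124 {L : Type*} [LieRing L] [LieAlgebra ℝ L] [FiniteDimensional ℝ L]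
    (g : InvariantMetric L) : Set (OrthogonalACS g) :=
  {J | nablaOmega J ∈ W₁ J ⊔ W₂ J ⊔ W₄ J}

end AlmostHermitian

end

open AlmostHermitian

/-! Since the Levi-Civita connection is torsion-free, $d\omega$ is the cyclic sum of $\nabla\omega$.
Inside $\mathcal W$ the kernel of the cyclic sum is $\mathcal W_2$ by definition. The cyclic sum
multiplies $\mathcal W_1$ by 3, landing in the real forms of type $(3,0)+(0,3)$, and sends the
element of $\mathcal W_4$ with parameter $\theta$ to $2\,\omega\wedge(\theta\circ J)$. Conversely,
if $d\omega$ lies in $\bigwedge^{3,0}+\bigwedge^{0,3}+\omega\wedge\bigwedge^1$, one can choose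
$T_1\in\mathcal W_1$ and $T_4\in\mathcal W_4$ with the same cyclic sum as $\nabla\omega$; the
difference is then in $\mathcal W_2$. So $J\in\mathcal Z_{124}$ exactly when $d\omega$ has no
effective component (`IsUnitaryCoframe.mem_Z124_iff`), and $\mathcal W_3$ never has to be described.

The rest is linear algebra in the coframe. The 3-forms are spanned by the non-effective ones, the
$\eta_i$ and the $\bar\eta_i$ (`IsUnitaryCoframe.sup_eq_top`). Wedging with $\eta_i$ kills the
non-effective forms, every $\eta_j$, and every $\bar\eta_j$ with $j\ne i$, while
$\bar\eta_i\wedge\eta_i\ne0$. Hence $d\omega\wedge\eta_i$ reads off the coefficient $c_i$, and all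
six products vanish exactly when the effective part does. Top-degree products of coframe members are
integer multiples of one volume form, so these relations become finite checks of signs. -/

noncomputable section

namespace AlmostHermitian

/-! ### Wedge products of 1-forms as determinants; complex bilinearity and conjugation -/

section Decomposable

variable {L : Type*} [AddCommGroup L] [Module ℝ L]

/-- A 1-form as a linear map. -/
def oneFormLin (a : Form L 1) : L →ₗ[ℝ] ℂ where
  toFun X := a ![X]
  map_add' X Y := a.map_vecCons_add ![] X Y
  map_smul' t X := a.map_vecCons_smul ![] t X

@[simp] theorem oneFormLin_apply (a : Form L 1) (X : L) : oneFormLin a X = a ![X] := rfl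

/-- Evaluation of forms at a tuple of vectors. -/
def evalForm {n : ℕ} (v : Fin n → L) : Form L n →ₗ[ℂ] ℂ where
  toFun φ := φ v
  map_add' _ _ := rfl
  map_smul' _ _ := rfl

@[simp] theorem evalForm_apply {n : ℕ} (v : Fin n → L) (φ : Form L n) : evalForm v φ = φ v := rfl

/-- The multilinear map `v ↦ ∏ i, a i (v i)`. -/
def prodForm {ι : Type*} [Fintype ι] (a : ι → Form L 1) : MultilinearMap ℝ (fun _ : ι ↦ L) ℂ :=
  (MultilinearMap.mkPiAlgebra ℝ ι ℂ).compLinearMap fun i ↦ oneFormLin (a i)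

@[simp] theorem prodForm_apply {ι : Type*} [Fintype ι] (a : ι → Form L 1) (v : ι → L) :
    prodForm a v = ∏ i, a i ![v i] := by simp [prodForm]

theorem prodForm_alternatization_apply {ι : Type*} [Fintype ι] [DecidableEq ι]
    (a : ι → Form L 1) (v : ι → L) :
    MultilinearMap.alternatization (prodForm a) v =
      (Matrix.of fun i j ↦ a i ![v j]).det := by
  rw [MultilinearMap.alternatization_apply, ← Matrix.det_transpose, Matrix.det_apply]
  simp

theorem of_update_eq_updateRow {n : ℕ} (a : Fin n → Form L 1) (i : Fin n) (x : Form L 1)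
    (v : Fin n → L) :
    (Matrix.of fun p q ↦ (Function.update a i x p) ![v q]) =
      (Matrix.of fun p q ↦ a p ![v q]).updateRow i fun q ↦ x ![v q] := by
  ext p q
  by_cases h : p = i
  · subst h; simp
  · simp [h]

/-- The wedge product `a 0 ∧ ⋯ ∧ a (n - 1)` of 1-forms, as a determinant. -/
def decomp {n : ℕ} : (Form L 1) [⋀^Fin n]→ₗ[ℂ] Form L n where
  toFun a := MultilinearMap.alternatization (prodForm a)
  map_update_add' := by
    intro inst a i x y
    obtain rfl := Subsingleton.elim inst (instDecidableEqFin n)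
    ext v
    simp only [AlternatingMap.add_apply, prodForm_alternatization_apply, of_update_eq_updateRow]
    exact Matrix.det_updateRow_add _ i (fun j ↦ x ![v j]) (fun j ↦ y ![v j])
  map_update_smul' := by
    intro inst a i c x
    obtain rfl := Subsingleton.elim inst (instDecidableEqFin n)
    ext v
    simp only [AlternatingMap.smul_apply, prodForm_alternatization_apply, of_update_eq_updateRow]
    exact Matrix.det_updateRow_smul _ i c (fun j ↦ x ![v j])
  map_eq_zero_of_eq' := by
    intro a i j h hij
    ext v
    simp only [AlternatingMap.zero_apply, prodForm_alternatization_apply]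
    exact Matrix.det_zero_of_row_eq hij (by ext; simp [h])

theorem decomp_apply {n : ℕ} (a : Fin n → Form L 1) (v : Fin n → L) :
    decomp a v = (Matrix.of fun i j ↦ a i ![v j]).det :=
  prodForm_alternatization_apply a v

/-- Alternatization turns the tensor product of multilinear maps into the shuffle product, so no
factorials appear in this normalisation. The result is a determinant indexed by a sum type,
reindexed along `finSumFinEquiv`. -/
theorem decomp_wedge {k l : ℕ} (a : Fin k → Form L 1) (b : Fin l → Form L 1) :
    decomp a ⋏ decomp b = decomp (Fin.append a b) := by
  have h : (LinearMap.mul' ℝ ℂ).compAlternatingMap ((decomp a).domCoprod (decomp b)) =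
      MultilinearMap.alternatization (prodForm (Sum.elim a b)) := by
    change (LinearMap.mul' ℝ ℂ).compAlternatingMap
      ((MultilinearMap.alternatization (prodForm a)).domCoprod
        (MultilinearMap.alternatization (prodForm b))) = _
    rw [← MultilinearMap.domCoprod_alternization, ← LinearMap.compMultilinearMap_alternatization]
    congr 1
    ext v
    simp [MultilinearMap.domCoprod_apply]
  ext v
  rw [wedge, h, AlternatingMap.domDomCongr_apply, prodForm_alternatization_apply, decomp_apply,
    ← Matrix.det_submatrix_equiv_self finSumFinEquiv]
  congr 1
  ext i j
  cases i <;> simp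

theorem decomp_one (a : Form L 1) : decomp ![a] = a := by
  ext v
  rw [decomp_apply, Matrix.det_unique]
  simp only [Fin.default_eq_zero, Matrix.of_apply, Matrix.cons_val_zero]
  congr 1
  ext i
  fin_cases i
  rfl

theorem wedge_one_one (a b : Form L 1) : a ⋏ b = decomp ![a, b] := by
  conv_lhs => rw [← decomp_one a, ← decomp_one b, decomp_wedge]
  congr 1
  ext i
  fin_cases i <;> rfl

theorem wedge_two_one (a b c : Form L 1) : decomp ![a, b] ⋏ c = decomp ![a, b, c] := by
  conv_lhs => rw [← decomp_one c, decomp_wedge]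
  congr 1
  ext i
  fin_cases i <;> rfl

theorem wedge_one_one_one (a b c : Form L 1) : a ⋏ b ⋏ c = decomp ![a, b, c] := by
  rw [wedge_one_one, wedge_two_one]

/-- Forms are alternating over ℝ with values in ℂ, so complex homogeneity does not follow from the
real bilinearity of `domCoprod`; it is checked on each shuffle. -/
theorem smul_wedge {k l : ℕ} (c : ℂ) (a : Form L k) (b : Form L l) :
    (c • a) ⋏ b = c • (a ⋏ b) := by
  ext v
  simp only [wedge, AlternatingMap.domDomCongr_apply, AlternatingMap.smul_apply,
    LinearMap.compAlternatingMap_apply, AlternatingMap.domCoprod_apply, _root_.sum_apply,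
    map_sum, Finset.smul_sum]
  refine Finset.sum_congr rfl fun σ _ ↦ ?_
  induction σ using Quotient.inductionOn' with
  | h σ => simp [AlternatingMap.domCoprod.summand_mk'', mul_smul_comm, mul_assoc]

theorem wedge_smul {k l : ℕ} (c : ℂ) (a : Form L k) (b : Form L l) :
    a ⋏ (c • b) = c • (a ⋏ b) := by
  ext v
  simp only [wedge, AlternatingMap.domDomCongr_apply, AlternatingMap.smul_apply,
    LinearMap.compAlternatingMap_apply, AlternatingMap.domCoprod_apply, _root_.sum_apply,
    map_sum, Finset.smul_sum]
  refine Finset.sum_congr rfl fun σ _ ↦ ?_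
  induction σ using Quotient.inductionOn' with
  | h σ => simp [AlternatingMap.domCoprod.summand_mk'', mul_smul_comm, mul_left_comm]

theorem add_wedge {k l : ℕ} (a a' : Form L k) (b : Form L l) :
    (a + a') ⋏ b = a ⋏ b + a' ⋏ b := by
  ext v
  simp only [wedge, ← AlternatingMap.domCoprod'_apply, TensorProduct.add_tmul, map_add]
  simp

theorem wedge_add {k l : ℕ} (a : Form L k) (b b' : Form L l) :
    a ⋏ (b + b') = a ⋏ b + a ⋏ b' := by
  ext v
  simp only [wedge, ← AlternatingMap.domCoprod'_apply, TensorProduct.tmul_add, map_add]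
  simp

/-- The wedge product as a bilinear map. -/
def wedgeBilin (k l : ℕ) : Form L k →ₗ[ℂ] Form L l →ₗ[ℂ] Form L (k + l) :=
  LinearMap.mk₂ ℂ wedge add_wedge smul_wedge wedge_add wedge_smul

@[simp] theorem wedgeBilin_apply {k l : ℕ} (a : Form L k) (b : Form L l) :
    wedgeBilin k l a b = a ⋏ b := rfl

theorem zero_wedge {k l : ℕ} (b : Form L l) : (0 : Form L k) ⋏ b = 0 :=
  LinearMap.map_zero₂ (wedgeBilin k l) b

theorem conjForm_wedge {k l : ℕ} (a : Form L k) (b : Form L l) :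
    conjForm (a ⋏ b) = conjForm a ⋏ conjForm b := by
  ext v
  simp only [conjForm, wedge, AlternatingMap.domDomCongr_apply,
    LinearMap.compAlternatingMap_apply, AlternatingMap.domCoprod_apply, _root_.sum_apply,
    map_sum]
  refine Finset.sum_congr rfl fun σ _ ↦ ?_
  induction σ using Quotient.inductionOn' with
  | h σ => rcases Int.units_eq_one_or (Equiv.Perm.sign σ) with h | h <;>
      simp [AlternatingMap.domCoprod.summand_mk'', h]

/-- Conjugation as a semilinear map. -/
def conjFormLin (k : ℕ) : Form L k →ₛₗ[starRingEnd ℂ] Form L k where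
  toFun := conjForm
  map_add' a b := by ext v; simp [conjForm]
  map_smul' c a := by ext v; simp [conjForm]

@[simp] theorem conjFormLin_apply {k : ℕ} (a : Form L k) : conjFormLin k a = conjForm a := rfl

@[simp] theorem conjForm_apply {k : ℕ} (a : Form L k) (v : Fin k → L) :
    conjForm a v = (starRingEnd ℂ) (a v) := rfl

@[simp] theorem conjForm_conjForm {k : ℕ} (a : Form L k) : conjForm (conjForm a) = a := by
  ext v; simp

theorem conjForm_decomp {n : ℕ} (a : Fin n → Form L 1) :
    conjForm (decomp a) = decomp fun i ↦ conjForm (a i) := by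
  ext v
  rw [conjForm_apply, decomp_apply, decomp_apply, RingHom.map_det]
  rfl

theorem decomp_compLinearMap {n : ℕ} (a : Fin n → Form L 1) (f : L →ₗ[ℝ] L) :
    (decomp a).compLinearMap f = decomp fun i ↦ (a i).compLinearMap f := by
  ext v
  rw [AlternatingMap.compLinearMap_apply, decomp_apply, decomp_apply]
  congr 1
  ext i j
  simp only [Matrix.of_apply, AlternatingMap.compLinearMap_apply]
  congr 1
  ext q
  fin_cases q
  rfl

end Decomposable

/-- The sign of a self-map of `Fin n`: its sign as a permutation, and zero if it is not
injective. -/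
def mapSign {n : ℕ} (s : Fin n → Fin n) : ℤ :=
  ∏ j, ∏ i ∈ Finset.Iio j, if s i < s j then 1 else if s j < s i then -1 else 0

/-- For a permutation the sign is the product over inversions; a repeated index makes both sides
vanish. Since `mapSign` is computable, identities between products of coframe members can be settled
by `decide`. -/
theorem map_comp_eq_mapSign_smul {R M N : Type*} [CommRing R] [AddCommGroup M] [Module R M]
    [AddCommGroup N] [Module R N] {n : ℕ} (f : M [⋀^Fin n]→ₗ[R] N) (v : Fin n → M)
    (s : Fin n → Fin n) : f (v ∘ s) = mapSign s • f v := by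
  by_cases hs : Function.Injective s
  · obtain ⟨σ, rfl⟩ : ∃ σ : Equiv.Perm (Fin n), s = σ :=
      ⟨Equiv.ofBijective s (Finite.injective_iff_bijective.1 hs), rfl⟩
    rw [AlternatingMap.map_perm]
    have : ((Equiv.Perm.sign σ : ℤˣ) : ℤ) = mapSign σ := by
      rw [Equiv.Perm.sign_eq_prod_prod_Iio, mapSign, Units.coe_prod]
      refine Finset.prod_congr rfl fun j _ ↦ ?_
      rw [Units.coe_prod]
      refine Finset.prod_congr rfl fun i hi ↦ ?_
      have hne : σ i ≠ σ j := fun h ↦ (Finset.mem_Iio.1 hi).ne (σ.injective h)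
      rcases lt_or_gt_of_ne hne with h | h
      · simp [h]
      · simp [h, h.not_gt]
    rw [← this]
    rfl
  · obtain ⟨i, j, hij, hne⟩ : ∃ i j, s i = s j ∧ i < j := by
      simp only [Function.Injective, not_forall] at hs
      obtain ⟨i, j, h, hne⟩ := hs
      rcases lt_or_gt_of_ne hne with h' | h'
      · exact ⟨i, j, h, h'⟩
      · exact ⟨j, i, h.symm, h'⟩
    rw [f.map_eq_zero_of_eq (v ∘ s) (by simp [hij]) hne.ne, mapSign,
      Finset.prod_eq_zero (Finset.mem_univ j)
        (Finset.prod_eq_zero (Finset.mem_Iio.2 hne) (by simp [hij])), zero_smul]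

/-! ### The unitary coframe: nondegeneracy, spanning, and the volume form -/

section Coframe

variable {L : Type*} [AddCommGroup L] [Module ℝ L]

/-- The 1-forms `α, β, γ, ᾱ, β̄, γ̄`. -/
def frame (α β γ : Form L 1) : Fin 6 → Form L 1 :=
  ![α, β, γ, conjForm α, conjForm β, conjForm γ]

theorem conjForm_frame (α β γ : Form L 1) (i : Fin 6) :
    conjForm (frame α β γ i) = frame α β γ (i + 3) := by
  fin_cases i <;> simp [frame]

theorem wedge_conj_apply (a b : Form L 1) (X Y : L) :
    (a ⋏ conjForm b) ![X, Y] = a ![X] * (starRingEnd ℂ) (b ![Y]) -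
      a ![Y] * (starRingEnd ℂ) (b ![X]) := by
  rw [wedge_one_one, decomp_apply, Matrix.det_fin_two]
  simp

variable {g : InvariantMetric L} {J : OrthogonalACS g} {α β γ : Form L 1}

/-- Evaluating $\omega(X,JX)=g(X,X)$ through the coframe gives a combination of products, each
containing the value at $X$ of one of the three forms or its conjugate, so positivity of $g$ forces
$X=0$. -/
theorem IsUnitaryCoframe.eq_zero (h : IsUnitaryCoframe J α β γ) {X : L} (hα : α ![X] = 0)
    (hβ : β ![X] = 0) (hγ : γ ![X] = 0) : X = 0 := by
  by_contra hX
  have h0 : fundamentalForm J ![X, J.map X] = ((g.form X X : ℝ) : ℂ) := by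
    rw [← J.orth X X]; rfl
  rw [h.fundamental] at h0
  simp only [AlternatingMap.smul_apply, AlternatingMap.add_apply, wedge_conj_apply, hα, hβ, hγ,
    map_zero, h.left X, h.mid X, h.right X] at h0
  simp at h0
  exact (g.pos X hX).ne (by exact_mod_cast h0)

theorem IsUnitaryCoframe.exists_vec (h : IsUnitaryCoframe J α β γ)
    (hdim : Module.finrank ℝ L = 6) (z : Fin 3 → ℂ) :
    ∃ X : L, α ![X] = z 0 ∧ β ![X] = z 1 ∧ γ ![X] = z 2 := by
  have : FiniteDimensional ℝ L := Module.finite_of_finrank_eq_succ hdim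
  let Φ : L →ₗ[ℝ] (Fin 3 → ℂ) :=
    LinearMap.pi ![oneFormLin α, oneFormLin β, oneFormLin γ]
  have hinj : Function.Injective Φ := by
    rw [injective_iff_map_eq_zero]
    intro X hX
    exact h.eq_zero (congrFun hX 0) (congrFun hX 1) (congrFun hX 2)
  have hsurj : Function.Surjective Φ := by
    refine (LinearMap.injective_iff_surjective_of_finrank_eq_finrank ?_).1 hinj
    rw [hdim, Module.finrank_pi_fintype]
    simp
  obtain ⟨X, hX⟩ := hsurj z
  exact ⟨X, congrFun hX 0, congrFun hX 1, congrFun hX 2⟩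

/-- A real coordinate system on `L` whose coordinates are combinations of the coframe and its
conjugate. -/
theorem IsUnitaryCoframe.exists_coord (h : IsUnitaryCoframe J α β γ)
    (hdim : Module.finrank ℝ L = 6) :
    ∃ (b : Fin 6 → L) (ξ : Fin 6 → Form L 1),
      (∀ i, ξ i ∈ Submodule.span ℂ (Set.range (frame α β γ))) ∧
      ∀ X, ∃ r : Fin 6 → ℝ, (∀ i, ξ i ![X] = r i) ∧ X = ∑ i, r i • b i := by
  choose w h0 h1 h2 using h.exists_vec hdim
  refine ⟨![w ![1, 0, 0], w ![0, 1, 0], w ![0, 0, 1], w ![Complex.I, 0, 0], w ![0, Complex.I, 0],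
      w ![0, 0, Complex.I]],
    ![(1 / 2 : ℂ) • (α + conjForm α), (1 / 2 : ℂ) • (β + conjForm β),
      (1 / 2 : ℂ) • (γ + conjForm γ), (-Complex.I / 2) • (α - conjForm α),
      (-Complex.I / 2) • (β - conjForm β), (-Complex.I / 2) • (γ - conjForm γ)], ?_, fun X ↦
    ⟨![(α ![X]).re, (β ![X]).re, (γ ![X]).re, (α ![X]).im, (β ![X]).im, (γ ![X]).im], ?_, ?_⟩⟩
  · have hm : ∀ i, frame α β γ i ∈ Submodule.span ℂ (Set.range (frame α β γ)) :=
      fun i ↦ Submodule.subset_span ⟨i, rfl⟩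
    intro i
    fin_cases i
    · exact Submodule.smul_mem _ _ (Submodule.add_mem _ (hm 0) (hm 3))
    · exact Submodule.smul_mem _ _ (Submodule.add_mem _ (hm 1) (hm 4))
    · exact Submodule.smul_mem _ _ (Submodule.add_mem _ (hm 2) (hm 5))
    · exact Submodule.smul_mem _ _ (Submodule.sub_mem _ (hm 0) (hm 3))
    · exact Submodule.smul_mem _ _ (Submodule.sub_mem _ (hm 1) (hm 4))
    · exact Submodule.smul_mem _ _ (Submodule.sub_mem _ (hm 2) (hm 5))
  · intro i
    fin_cases i <;> simp [Complex.ext_iff] <;> ring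
  · rw [← sub_eq_zero]
    have hc : ∀ a : Form L 1, ∀ (b : Fin 6 → L) (r : Fin 6 → ℝ),
        a ![X - ∑ i, r i • b i] = a ![X] - ∑ i, r i * a ![b i] := by
      intro a b r
      simp only [← oneFormLin_apply, map_sub, map_sum, map_smul, Complex.real_smul]
    apply h.eq_zero
    · rw [hc, Fin.sum_univ_six]
      simp [h0]
    · rw [hc, Fin.sum_univ_six]
      simp [h1]
    · rw [hc, Fin.sum_univ_six]
      simp [h2]

theorem map_mem_span_of_mem_span {V W ι κ : Type*} [Fintype ι] [Fintype κ]
    [AddCommGroup V] [Module ℂ V] [AddCommGroup W] [Module ℂ W]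
    (f : MultilinearMap ℂ (fun _ : ι ↦ V) W) (θ : ι → κ → V) (ξ : ι → V)
    (h : ∀ i, ξ i ∈ Submodule.span ℂ (Set.range (θ i))) :
    f ξ ∈ Submodule.span ℂ (Set.range fun s : ι → κ ↦ f fun i ↦ θ i (s i)) := by
  classical
  simp only [Submodule.mem_span_range_iff_exists_fun] at h
  choose x hx using h
  obtain rfl : (fun i ↦ ∑ j, x i j • θ i j) = ξ := funext hx
  rw [MultilinearMap.map_sum]
  refine Submodule.sum_mem _ fun s _ ↦ ?_
  rw [MultilinearMap.map_smul_univ]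
  exact Submodule.smul_mem _ _ (Submodule.subset_span ⟨s, rfl⟩)

/-- The wedge products of the coframe and its conjugate span the forms. -/
theorem IsUnitaryCoframe.span_decomp_eq_top (h : IsUnitaryCoframe J α β γ)
    (hdim : Module.finrank ℝ L = 6) (n : ℕ) :
    Submodule.span ℂ (Set.range fun s : Fin n → Fin 6 ↦ decomp (frame α β γ ∘ s)) = ⊤ := by
  obtain ⟨b, ξ, hξ, hb⟩ := h.exists_coord hdim
  rw [eq_top_iff]
  rintro φ -
  -- The expansion of a multilinear map in real coordinates, the coordinate functions being the `ξ
  -- i`.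
  have hφ : (φ : MultilinearMap ℝ (fun _ : Fin n ↦ L) ℂ) =
      ∑ s : Fin n → Fin 6, φ (b ∘ s) • prodForm (ξ ∘ s) := by
    ext v
    choose r hr hv using fun i ↦ hb (v i)
    obtain rfl : (fun i ↦ ∑ j, r i j • b j) = v := (funext hv).symm
    rw [MultilinearMap.map_sum]
    simp only [MultilinearMap.map_smul_univ, _root_.sum_apply, _root_.smul_apply,
      prodForm_apply, Function.comp_apply, hr]
    refine Finset.sum_congr rfl fun s _ ↦ ?_
    simp only [Complex.real_smul, Complex.ofReal_prod, smul_eq_mul, mul_comm]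
    rfl
  -- Alternatizing a map that is already alternating multiplies it by $n!$, and turns each product
  -- of coordinates into a wedge product.
  have hsum : (n.factorial : ℂ) • φ = ∑ s : Fin n → Fin 6, φ (b ∘ s) • decomp (ξ ∘ s) := by
    have := congrArg MultilinearMap.alternatization hφ
    rw [AlternatingMap.coe_alternatization, map_sum, Fintype.card_fin] at this
    rw [Nat.cast_smul_eq_nsmul, this]
    refine Finset.sum_congr rfl fun s _ ↦ ?_
    ext v
    simp only [AlternatingMap.smul_apply, decomp_apply, ← prodForm_alternatization_apply,
      MultilinearMap.alternatization_apply, Finset.smul_sum, MultilinearMap.domDomCongr_apply,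
      _root_.smul_apply]
    exact Finset.sum_congr rfl fun σ _ ↦ smul_comm _ _ _
  have hn : (n.factorial : ℂ) ≠ 0 := Nat.cast_ne_zero.2 n.factorial_ne_zero
  rw [← Submodule.smul_mem_iff _ hn, hsum]
  exact Submodule.sum_mem _ fun s _ ↦ Submodule.smul_mem _ _
    (map_mem_span_of_mem_span (decomp (n := n) (L := L)).toMultilinearMap (fun _ ↦ frame α β γ) (ξ ∘ s)
      fun i ↦ hξ (s i))

/-- The volume form built from the coframe does not vanish. -/
theorem IsUnitaryCoframe.decomp_frame_ne_zero (h : IsUnitaryCoframe J α β γ)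
    (hdim : Module.finrank ℝ L = 6) : decomp (frame α β γ) ≠ 0 := by
  intro h0
  have : FiniteDimensional ℝ L := Module.finite_of_finrank_eq_succ hdim
  -- Every 6-form is a multiple of the frame product, so if that product vanished there would be no
  -- nonzero 6-form, contradicting the determinant of a basis.
  have hz : ∀ φ : Form L 6, φ = 0 := by
    intro φ
    have hφ : φ ∈ (⊤ : Submodule ℂ (Form L 6)) := trivial
    rw [← h.span_decomp_eq_top hdim 6] at hφ
    have hr : (Set.range fun s : Fin 6 → Fin 6 ↦ decomp (frame α β γ ∘ s)) ⊆ {0} := by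
      rintro _ ⟨s, rfl⟩
      simp [map_comp_eq_mapSign_smul, h0]
    simpa using Submodule.span_mono hr hφ
  let b := Module.finBasisOfFinrankEq ℝ L hdim
  have := DFunLike.congr_fun
    (hz (Complex.ofRealCLM.toLinearMap.compAlternatingMap b.det)) ⇑b
  simp [b.det_self] at this

end Coframe

/-! ### Products of coframe members and the pairing of 3-forms into top degree -/

/-- The first three indices of `Fin 6`, those of the `(1,0)`-forms of a frame. -/
abbrev lo (k : Fin 3) : Fin 6 := Fin.castAdd 3 k

/-- The last three indices of `Fin 6`, those of the `(0,1)`-forms of a frame. -/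
abbrev hi (k : Fin 3) : Fin 6 := Fin.natAdd 3 k

theorem exists_lo_or_hi (i : Fin 6) : (∃ k, i = lo k) ∨ ∃ k, i = hi k := by
  revert i; decide

theorem lo_add_three (k : Fin 3) : lo k + 3 = hi k := by revert k; decide

theorem hi_add_three (k : Fin 3) : hi k + 3 = lo k := by revert k; decide

section FrameForm

variable {L : Type*} [AddCommGroup L] [Module ℝ L]

/-- The wedge product of the members of the frame with indices `s 0, s 1, …`. -/
def frameForm (α β γ : Form L 1) {n : ℕ} (s : Fin n → Fin 6) : Form L n :=
  decomp (frame α β γ ∘ s)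

variable (α β γ : Form L 1)

theorem frameForm_wedge {k l : ℕ} (s : Fin k → Fin 6) (t : Fin l → Fin 6) :
    frameForm α β γ s ⋏ frameForm α β γ t = frameForm α β γ (Fin.append s t) := by
  rw [frameForm, frameForm, decomp_wedge, frameForm]
  congr 1
  ext i : 1
  refine Fin.addCases (fun i ↦ ?_) (fun i ↦ ?_) i <;> simp

theorem conjForm_frameForm {n : ℕ} (s : Fin n → Fin 6) :
    conjForm (frameForm α β γ s) = frameForm α β γ fun i ↦ s i + 3 := by
  rw [frameForm, conjForm_decomp, frameForm]
  congr 1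
  ext i : 1
  exact conjForm_frame α β γ (s i)

theorem frameForm_comp {n : ℕ} (t : Fin n → Fin 6) (s : Fin n → Fin n) :
    frameForm α β γ (t ∘ s) = mapSign s • frameForm α β γ t :=
  map_comp_eq_mapSign_smul decomp (frame α β γ ∘ t) s

theorem frameForm_eq_zero {n : ℕ} (s : Fin n → Fin 6) (h : ∃ i j, s i = s j ∧ i ≠ j) :
    frameForm α β γ s = 0 := by
  obtain ⟨i, j, h, hij⟩ := h
  exact decomp.map_eq_zero_of_eq _ (by simp [h]) hij

theorem frameForm_six (s : Fin 6 → Fin 6) :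
    frameForm α β γ s = mapSign s • decomp (frame α β γ) :=
  map_comp_eq_mapSign_smul decomp _ s

theorem frameForm_one (i : Fin 6) : frameForm α β γ ![i] = frame α β γ i := by
  rw [← decomp_one (frame α β γ i), frameForm]
  congr 1
  ext j : 1
  fin_cases j
  rfl

theorem frameForm_three (i j k : Fin 6) : frameForm α β γ ![i, j, k] =
    frame α β γ i ⋏ frame α β γ j ⋏ frame α β γ k := by
  rw [wedge_one_one_one, frameForm]
  congr 1
  ext p : 1
  fin_cases p <;> rfl

theorem frameForm_two (i j : Fin 6) : frameForm α β γ ![i, j] =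
    frame α β γ i ⋏ frame α β γ j := by
  rw [wedge_one_one, frameForm]
  congr 1
  ext p : 1
  fin_cases p <;> rfl

theorem frameForm_swap (i j k : Fin 6) :
    frameForm α β γ ![j, i, k] = -frameForm α β γ ![i, j, k] := by
  have : ![j, i, k] = ![i, j, k] ∘ ![1, 0, 2] := by ext p; fin_cases p <;> rfl
  rw [this, frameForm_comp, show mapSign ![1, 0, 2] = -1 by decide, neg_one_smul]

theorem frameForm_rotate (i j k : Fin 6) :
    frameForm α β γ ![j, k, i] = frameForm α β γ ![i, j, k] := by
  have : ![j, k, i] = ![i, j, k] ∘ ![1, 2, 0] := by ext p; fin_cases p <;> rfl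
  rw [this, frameForm_comp, show mapSign ![1, 2, 0] = 1 by decide, one_smul]

/-- The indices of the first term of each `eta`. -/
def etaFst : Fin 6 → Fin 3 → Fin 6 :=
  ![![0, 1, 5], ![1, 2, 3], ![0, 2, 4], ![0, 1, 4], ![1, 0, 3], ![2, 0, 3]]

/-- The indices of the second term of each `eta`, with a repetition where there is no such
term. -/
def etaSnd : Fin 6 → Fin 3 → Fin 6 :=
  ![![0, 0, 3], ![0, 0, 3], ![0, 0, 3], ![0, 2, 5], ![1, 2, 5], ![2, 1, 4]]

/-- Giving all six forms the same shape, a difference of two frame products, lets a single integer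
table `pairing` treat them together. -/
theorem eta_eq (i : Fin 6) :
    eta α β γ i = frameForm α β γ (etaFst i) - frameForm α β γ (etaSnd i) := by
  have h0 : frameForm α β γ ![0, 0, 3] = 0 := frameForm_eq_zero _ _ _ _ (by decide)
  fin_cases i
  · change _ = frameForm α β γ ![0, 1, 5] - frameForm α β γ ![0, 0, 3]
    rw [h0, frameForm_three, sub_zero]; rfl
  · change _ = frameForm α β γ ![1, 2, 3] - frameForm α β γ ![0, 0, 3]
    rw [h0, frameForm_three, sub_zero]; rfl
  · change _ = frameForm α β γ ![0, 2, 4] - frameForm α β γ ![0, 0, 3]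
    rw [h0, frameForm_three, sub_zero]; rfl
  · change _ = frameForm α β γ ![0, 1, 4] - frameForm α β γ ![0, 2, 5]
    rw [frameForm_three, frameForm_three]; rfl
  · change _ = frameForm α β γ ![1, 0, 3] - frameForm α β γ ![1, 2, 5]
    rw [frameForm_three, frameForm_three]; rfl
  · change _ = frameForm α β γ ![2, 0, 3] - frameForm α β γ ![2, 1, 4]
    rw [frameForm_three, frameForm_three]; rfl

theorem wedge_sub {k l : ℕ} (a : Form L k) (b b' : Form L l) :
    a ⋏ (b - b') = a ⋏ b - a ⋏ b' := map_sub (wedgeBilin k l a) b b'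

theorem sub_wedge {k l : ℕ} (a a' : Form L k) (b : Form L l) :
    (a - a') ⋏ b = a ⋏ b - a' ⋏ b := LinearMap.map_sub₂ (wedgeBilin k l) a a' b

theorem sum_wedge {ι : Type*} (t : Finset ι) {k l : ℕ} (a : ι → Form L k) (b : Form L l) :
    (∑ i ∈ t, a i) ⋏ b = ∑ i ∈ t, a i ⋏ b := LinearMap.map_sum₂ (wedgeBilin k l) t a b

theorem wedge_sum {ι : Type*} (t : Finset ι) {k l : ℕ} (a : Form L k) (b : ι → Form L l) :
    a ⋏ (∑ i ∈ t, b i) = ∑ i ∈ t, a ⋏ b i := map_sum (wedgeBilin k l a) b t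

theorem conjForm_sub {k : ℕ} (a b : Form L k) : conjForm (a - b) = conjForm a - conjForm b :=
  map_sub (conjFormLin k) a b

/-- The number `c` with `(θ_p - θ_q) ∧ (θ_r - θ_s) = c vol`. -/
def pairing (p q r s : Fin 3 → Fin 6) : ℤ :=
  mapSign (n := 6) (Fin.append p r) - mapSign (n := 6) (Fin.append p s) -
    (mapSign (n := 6) (Fin.append q r) - mapSign (n := 6) (Fin.append q s))

theorem sub_wedge_sub_eq_pairing (p q r s : Fin 3 → Fin 6) :
    (frameForm α β γ p - frameForm α β γ q) ⋏ (frameForm α β γ r - frameForm α β γ s) =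
      pairing p q r s • decomp (frame α β γ) := by
  have h : ∀ a b : Fin 3 → Fin 6, frameForm α β γ a ⋏ frameForm α β γ b =
      mapSign (n := 6) (Fin.append a b) • decomp (frame α β γ) := fun a b ↦ by
    rw [frameForm_wedge]; exact frameForm_six _ _ _ _
  rw [sub_wedge, wedge_sub, wedge_sub, h, h, h, h, pairing]
  simp only [sub_smul]

theorem conj_eta_wedge_eta (i j : Fin 6) :
    conjForm (eta α β γ i) ⋏ eta α β γ j =
      pairing (fun k ↦ etaFst i k + 3) (fun k ↦ etaSnd i k + 3) (etaFst j) (etaSnd j) •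
        decomp (frame α β γ) := by
  rw [eta_eq, eta_eq, conjForm_sub, conjForm_frameForm, conjForm_frameForm,
    sub_wedge_sub_eq_pairing]

/-- A product of two monomials survives only if their index sets are complementary. The complement
of the conjugate of $\alpha\beta\bar\gamma$ is $\alpha\beta\bar\gamma$ itself, and that of the
conjugate of $\alpha\beta\bar\beta$ is $\alpha\gamma\bar\gamma$, the other term of the same
$\eta_4$; the remaining forms behave alike. -/
theorem conj_eta_wedge_eta_of_ne {i j : Fin 6} (hij : i ≠ j) :
    conjForm (eta α β γ i) ⋏ eta α β γ j = 0 := by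
  have : ∀ i j : Fin 6, i ≠ j →
      pairing (fun k ↦ etaFst i k + 3) (fun k ↦ etaSnd i k + 3) (etaFst j) (etaSnd j) = 0 := by
    decide +kernel
  rw [conj_eta_wedge_eta, this i j hij, zero_smul]

/-- The product would have type $(4,2)$, and there are only three independent $(1,0)$-forms. -/
theorem eta_wedge_eta (i j : Fin 6) : eta α β γ i ⋏ eta α β γ j = 0 := by
  have : ∀ i j : Fin 6, pairing (etaFst i) (etaSnd i) (etaFst j) (etaSnd j) = 0 := by
    decide +kernel
  rw [eta_eq, eta_eq, sub_wedge_sub_eq_pairing, this i j, zero_smul]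

end FrameForm

/-! ### Effectiveness and independence of the six forms -/

section Hermitian

variable {L : Type*} [AddCommGroup L] [Module ℝ L] {g : InvariantMetric L} {J : OrthogonalACS g}
  {α β γ : Form L 1}

theorem IsUnitaryCoframe.conj_eta_wedge_eta_ne_zero (h : IsUnitaryCoframe J α β γ)
    (hdim : Module.finrank ℝ L = 6) (i : Fin 6) :
    conjForm (eta α β γ i) ⋏ eta α β γ i ≠ 0 := by
  have : ∀ i : Fin 6,
      pairing (fun k ↦ etaFst i k + 3) (fun k ↦ etaSnd i k + 3) (etaFst i) (etaSnd i) ≠ 0 := by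
    decide +kernel
  rw [conj_eta_wedge_eta, ← Int.cast_smul_eq_zsmul ℂ]
  exact smul_ne_zero (Int.cast_ne_zero.2 (this i)) (h.decomp_frame_ne_zero hdim)

/-- Wedging a relation with $\bar\eta_i$ leaves only its $i$-th term. -/
theorem IsUnitaryCoframe.linearIndependent_eta (h : IsUnitaryCoframe J α β γ)
    (hdim : Module.finrank ℝ L = 6) : LinearIndependent ℂ (eta α β γ) := by
  rw [Fintype.linearIndependent_iff]
  intro c hc i
  have := congrArg (wedgeBilin 3 3 (conjForm (eta α β γ i))) hc
  rw [map_sum, Finset.sum_eq_single i, map_smul, map_zero, wedgeBilin_apply] at this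
  · exact (smul_eq_zero.1 this).resolve_right (h.conj_eta_wedge_eta_ne_zero hdim i)
  · intro j _ hj
    rw [map_smul, wedgeBilin_apply, conj_eta_wedge_eta_of_ne _ _ _ hj.symm, smul_zero]
  · simp

theorem IsUnitaryCoframe.isOneZero_frame (h : IsUnitaryCoframe J α β γ) (k : Fin 3) :
    IsOneZero J (frame α β γ (lo k)) := by
  fin_cases k
  · exact h.left
  · exact h.mid
  · exact h.right

theorem IsUnitaryCoframe.fundamentalForm_eq (h : IsUnitaryCoframe J α β γ) :
    fundamentalForm J = (Complex.I / 2) • ∑ k, frameForm α β γ ![lo k, hi k] := by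
  rw [h.fundamental]
  simp only [frameForm_two, Fin.sum_univ_three]
  rfl

theorem conjForm_fundamentalForm : conjForm (fundamentalForm J) = fundamentalForm J := by
  ext v
  exact Complex.conj_ofReal _

theorem IsUnitaryCoframe.fundamentalForm_wedge (h : IsUnitaryCoframe J α β γ) {n : ℕ}
    (s : Fin n → Fin 6) : fundamentalForm J ⋏ frameForm α β γ s =
      (Complex.I / 2) • ∑ k, frameForm α β γ (Fin.append ![lo k, hi k] s) := by
  rw [h.fundamentalForm_eq, smul_wedge, sum_wedge]
  simp only [frameForm_wedge]

/-- The forms `eta` are effective. -/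
theorem IsUnitaryCoframe.fundamentalForm_wedge_eta (h : IsUnitaryCoframe J α β γ) (i : Fin 6) :
    fundamentalForm J ⋏ eta α β γ i = 0 := by
  rw [eta_eq, wedge_sub, h.fundamentalForm_wedge, h.fundamentalForm_wedge, ← smul_sub,
    Fin.sum_univ_three, Fin.sum_univ_three]
  have hz : ∀ (k : Fin 3) (s : Fin 3 → Fin 6),
      (∃ i j, (Fin.append ![lo k, hi k] s) i = (Fin.append ![lo k, hi k] s) j ∧ i ≠ j) →
      frameForm α β γ (Fin.append ![lo k, hi k] s) = 0 := fun k s ↦ frameForm_eq_zero _ _ _ _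
  have hs : ∀ (k l : Fin 3) (s t : Fin 3 → Fin 6) (σ : Fin 5 → Fin 5),
      Fin.append ![lo k, hi k] s = Fin.append ![lo l, hi l] t ∘ σ → mapSign σ = 1 →
      frameForm α β γ (Fin.append ![lo k, hi k] s) =
        frameForm α β γ (Fin.append ![lo l, hi l] t) := fun k l s t σ h1 h2 ↦ by
    rw [h1, frameForm_comp α β γ _ σ, h2, one_smul]
  rcases (by decide : ∀ i : Fin 6, i = 0 ∨ i = 1 ∨ i = 2 ∨ i = 3 ∨ i = 4 ∨ i = 5) i with
    rfl | rfl | rfl | rfl | rfl | rfl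
  · rw [hz 0 _ (by decide), hz 1 _ (by decide), hz 2 _ (by decide), hz 0 _ (by decide),
      hz 1 _ (by decide), hz 2 _ (by decide)]
    simp
  · rw [hz 0 _ (by decide), hz 1 _ (by decide), hz 2 _ (by decide), hz 0 _ (by decide),
      hz 1 _ (by decide), hz 2 _ (by decide)]
    simp
  · rw [hz 0 _ (by decide), hz 1 _ (by decide), hz 2 _ (by decide), hz 0 _ (by decide),
      hz 1 _ (by decide), hz 2 _ (by decide)]
    simp
  -- In $\omega\wedge\eta_4$ only $\gamma\bar\gamma\,\alpha\beta\bar\beta$ and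
  -- $\beta\bar\beta\,\alpha\gamma\bar\gamma$ survive. The permutation exchanges the two pairs, is
  -- even, and so makes them cancel. The last two cases are analogous.
  · rw [hz 0 (etaFst 3) (by decide), hz 1 (etaFst 3) (by decide), hz 0 (etaSnd 3) (by decide),
      hz 2 (etaSnd 3) (by decide),
      hs 2 1 (etaFst 3) (etaSnd 3) ![3, 4, 2, 0, 1] (by decide) (by decide)]
    simp
  · rw [hz 0 (etaFst 4) (by decide), hz 1 (etaFst 4) (by decide), hz 1 (etaSnd 4) (by decide),
      hz 2 (etaSnd 4) (by decide),
      hs 2 0 (etaFst 4) (etaSnd 4) ![3, 4, 2, 0, 1] (by decide) (by decide)]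
    simp
  · rw [hz 0 (etaFst 5) (by decide), hz 2 (etaFst 5) (by decide), hz 1 (etaSnd 5) (by decide),
      hz 2 (etaSnd 5) (by decide),
      hs 1 0 (etaFst 5) (etaSnd 5) ![3, 4, 2, 0, 1] (by decide) (by decide)]
    simp

theorem IsUnitaryCoframe.fundamentalForm_wedge_frame (h : IsUnitaryCoframe J α β γ) (i : Fin 6) :
    fundamentalForm J ⋏ frame α β γ i = (Complex.I / 2) • (frameForm α β γ ![0, 3, i] +
      frameForm α β γ ![1, 4, i] + frameForm α β γ ![2, 5, i]) := by
  rw [← frameForm_one, h.fundamentalForm_wedge, Fin.sum_univ_three]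
  congr! <;> (ext p; fin_cases p <;> rfl)

/-- The `(2,1)`-forms are combinations of the `eta` and of the products of `ω` and a
`(1,0)`-form. -/
theorem IsUnitaryCoframe.frameForm_mem_of_eta_mem (h : IsUnitaryCoframe J α β γ)
    (S : Submodule ℂ (Form L 3)) (hη : ∀ i, eta α β γ i ∈ S)
    (hω : ∀ k, fundamentalForm J ⋏ frame α β γ (lo k) ∈ S) (k l m : Fin 3) :
    frameForm α β γ ![lo k, lo l, hi m] ∈ S := by
  have hz : frameForm α β γ ![0, 0, 3] = 0 := frameForm_eq_zero _ _ _ _ (by decide)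
  have hI : ∀ x : Form L 3, (Complex.I / 2) • x ∈ S → x ∈ S := fun x hx ↦
    (Submodule.smul_mem_iff _ (div_ne_zero Complex.I_ne_zero two_ne_zero)).1 hx
  -- Up to the factor $i/2$, $\omega\wedge\alpha$ is the sum
  -- $\alpha\beta\bar\beta+\alpha\gamma\bar\gamma$, while $\eta_4$ is the difference of the same
  -- terms; together they give each term. The same holds for $\eta_5,\eta_6$ with $\beta,\gamma$.
  have hpair : ∀ x y : Form L 3, x - y ∈ S → x + y ∈ S → x ∈ S ∧ y ∈ S := fun x y h1 h2 ↦ by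
    have hx := Submodule.smul_mem S (1 / 2 : ℂ) (Submodule.add_mem _ h1 h2)
    have hy := Submodule.smul_mem S (1 / 2 : ℂ) (Submodule.sub_mem _ h2 h1)
    constructor
    · convert hx using 1; module
    · convert hy using 1; module
  have h0 : frameForm α β γ ![0, 1, 5] ∈ S := by
    have := hη 0
    rw [eta_eq] at this
    change frameForm α β γ ![0, 1, 5] - frameForm α β γ ![0, 0, 3] ∈ S at this
    rwa [hz, sub_zero] at this
  have h1 : frameForm α β γ ![1, 2, 3] ∈ S := by
    have := hη 1
    rw [eta_eq] at this
    change frameForm α β γ ![1, 2, 3] - frameForm α β γ ![0, 0, 3] ∈ S at this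
    rwa [hz, sub_zero] at this
  have h2 : frameForm α β γ ![0, 2, 4] ∈ S := by
    have := hη 2
    rw [eta_eq] at this
    change frameForm α β γ ![0, 2, 4] - frameForm α β γ ![0, 0, 3] ∈ S at this
    rwa [hz, sub_zero] at this
  have h3 : frameForm α β γ ![0, 1, 4] ∈ S ∧ frameForm α β γ ![0, 2, 5] ∈ S := by
    refine hpair _ _ ?_ (hI _ ?_)
    · have := hη 3
      rwa [eta_eq] at this
    · have := hω 0
      rw [h.fundamentalForm_wedge_frame] at this
      change (Complex.I / 2) • (frameForm α β γ ![0, 3, 0] + frameForm α β γ ![1, 4, 0] +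
        frameForm α β γ ![2, 5, 0]) ∈ S at this
      rwa [frameForm_eq_zero _ _ _ ![0, 3, 0] (by decide), zero_add, frameForm_rotate α β γ 0 1 4,
        frameForm_rotate α β γ 0 2 5] at this
  have h4 : frameForm α β γ ![1, 0, 3] ∈ S ∧ frameForm α β γ ![1, 2, 5] ∈ S := by
    refine hpair _ _ ?_ (hI _ ?_)
    · have := hη 4
      rwa [eta_eq] at this
    · have := hω 1
      rw [h.fundamentalForm_wedge_frame] at this
      change (Complex.I / 2) • (frameForm α β γ ![0, 3, 1] + frameForm α β γ ![1, 4, 1] +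
        frameForm α β γ ![2, 5, 1]) ∈ S at this
      rwa [frameForm_eq_zero _ _ _ ![1, 4, 1] (by decide), add_zero, frameForm_rotate α β γ 1 0 3,
        frameForm_rotate α β γ 1 2 5] at this
  have h5 : frameForm α β γ ![2, 0, 3] ∈ S ∧ frameForm α β γ ![2, 1, 4] ∈ S := by
    refine hpair _ _ ?_ (hI _ ?_)
    · have := hη 5
      rwa [eta_eq] at this
    · have := hω 2
      rw [h.fundamentalForm_wedge_frame] at this
      change (Complex.I / 2) • (frameForm α β γ ![0, 3, 2] + frameForm α β γ ![1, 4, 2] +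
        frameForm α β γ ![2, 5, 2]) ∈ S at this
      rwa [frameForm_eq_zero _ _ _ ![2, 5, 2] (by decide), add_zero, frameForm_rotate α β γ 2 0 3,
        frameForm_rotate α β γ 2 1 4] at this
  have hswap : ∀ i j k : Fin 6, frameForm α β γ ![i, j, k] ∈ S →
      frameForm α β γ ![j, i, k] ∈ S := fun i j k hS ↦ by
    rw [frameForm_swap]; exact Submodule.neg_mem _ hS
  have hdiag : ∀ i k : Fin 6, frameForm α β γ ![i, i, k] ∈ S := fun i k ↦ by
    rw [frameForm_eq_zero _ _ _ _ ⟨0, 1, rfl, by decide⟩]; exact Submodule.zero_mem _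
  fin_cases k <;> fin_cases l
  · exact hdiag _ _
  · fin_cases m
    · exact hswap _ _ _ h4.1
    · exact h3.1
    · exact h0
  · fin_cases m
    · exact hswap _ _ _ h5.1
    · exact h2
    · exact h3.2
  · fin_cases m
    · exact h4.1
    · exact hswap _ _ _ h3.1
    · exact hswap _ _ _ h0
  · exact hdiag _ _
  · fin_cases m
    · exact h1
    · exact hswap _ _ _ h5.2
    · exact h4.2
  · fin_cases m
    · exact h5.1
    · exact hswap _ _ _ h2
    · exact hswap _ _ _ h3.2
  · fin_cases m
    · exact hswap _ _ _ h1
    · exact h5.2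
    · exact hswap _ _ _ h4.2
  · exact hdiag _ _

end Hermitian

/-! ### Type decomposition of 3-forms and extraction of effective components -/

section Hermitian

variable {L : Type*} [AddCommGroup L] [Module ℝ L] {g : InvariantMetric L} {J : OrthogonalACS g}
  {α β γ : Form L 1}

theorem IsUnitaryCoframe.mem_span_frame (h : IsUnitaryCoframe J α β γ)
    (hdim : Module.finrank ℝ L = 6) (a : Form L 1) :
    a ∈ Submodule.span ℂ (Set.range (frame α β γ)) := by
  have ha : a ∈ (⊤ : Submodule ℂ (Form L 1)) := trivial
  rw [← h.span_decomp_eq_top hdim 1] at ha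
  refine Submodule.span_mono ?_ ha
  rintro _ ⟨s, rfl⟩
  refine ⟨s 0, ?_⟩
  rw [← decomp_one (frame α β γ (s 0))]
  congr 1
  ext i : 1
  fin_cases i
  rfl

theorem IsUnitaryCoframe.frame_hi_apply (h : IsUnitaryCoframe J α β γ) (k : Fin 3) (X : L) :
    frame α β γ (hi k) ![J.map X] = -Complex.I * frame α β γ (hi k) ![X] := by
  rw [← lo_add_three, ← conjForm_frame, conjForm_apply, conjForm_apply, h.isOneZero_frame k X]
  simp

/-- A unitary coframe spans the `(1,0)`-forms. -/
theorem IsUnitaryCoframe.mem_span_of_isOneZero (h : IsUnitaryCoframe J α β γ)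
    (hdim : Module.finrank ℝ L = 6) {a : Form L 1} (ha : IsOneZero J a) :
    a ∈ Submodule.span ℂ (Set.range fun k ↦ frame α β γ (lo k)) := by
  obtain ⟨x, hx⟩ := Submodule.mem_span_range_iff_exists_fun ℂ |>.1 (h.mem_span_frame hdim a)
  refine Submodule.mem_span_range_iff_exists_fun ℂ |>.2 ⟨fun k ↦ x (lo k), ?_⟩
  have hsum : ∀ X, a ![X] = ∑ k, x (lo k) * frame α β γ (lo k) ![X] +
      ∑ k, x (hi k) * frame α β γ (hi k) ![X] := fun X ↦ by
    rw [← hx, Fin.sum_univ_add (a := 3) (b := 3) fun i ↦ x i • frame α β γ i,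
      ← evalForm_apply]
    simp only [map_add, map_sum, map_smul, smul_eq_mul, evalForm_apply]
  have hker : ∀ X, ∑ k, x (hi k) * frame α β γ (hi k) ![X] = 0 := fun X ↦ by
    have h1 := hsum X
    have h2 := hsum (J.map X)
    simp only [ha X, h.isOneZero_frame _ X, h.frame_hi_apply, mul_left_comm _ Complex.I,
      mul_left_comm _ (-Complex.I), ← Finset.mul_sum] at h2
    -- Writing $a=P+Q$ with $P$ of type $(1,0)$ and $Q$ of type $(0,1)$, the condition $a\circ J=ia$
    -- reads $iP-iQ=iP+iQ$.
    have h3 : (2 * Complex.I) * ∑ k, x (hi k) * frame α β γ (hi k) ![X] = 0 := by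
      linear_combination h2 - Complex.I * h1
    simpa using h3
  ext v
  obtain ⟨X, rfl⟩ : ∃ X, v = ![X] := ⟨v 0, by ext i; fin_cases i; rfl⟩
  rw [hsum X, hker X, add_zero, ← evalForm_apply, map_sum]
  rfl

theorem conjForm_mem_span {ι : Type*} [Fintype ι] {n : ℕ} {θ : ι → Form L n} {a : Form L n}
    (ha : a ∈ Submodule.span ℂ (Set.range θ)) :
    conjForm a ∈ Submodule.span ℂ (Set.range fun i ↦ conjForm (θ i)) := by
  obtain ⟨x, rfl⟩ := Submodule.mem_span_range_iff_exists_fun ℂ |>.1 ha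
  refine Submodule.mem_span_range_iff_exists_fun ℂ |>.2 ⟨fun i ↦ starRingEnd ℂ (x i), ?_⟩
  rw [← conjFormLin_apply, map_sum]
  simp only [map_smulₛₗ, conjFormLin_apply]

theorem IsUnitaryCoframe.conjForm_mem_span_of_isOneZero (h : IsUnitaryCoframe J α β γ)
    (hdim : Module.finrank ℝ L = 6) {a : Form L 1} (ha : IsOneZero J a) :
    conjForm a ∈ Submodule.span ℂ (Set.range fun k ↦ frame α β γ (hi k)) := by
  simpa only [conjForm_frame, lo_add_three] using conjForm_mem_span (h.mem_span_of_isOneZero hdim ha)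

/-- The maps `e₀`, `e₁`, `e₂` select the holomorphic or antiholomorphic half of the frame in each
slot, so one statement serves the types $(2,1)$, $(3,0)$ and $(0,3)$. -/
theorem wedge_mem_of_frameForm_mem {e₀ e₁ e₂ : Fin 3 → Fin 6} {S : Submodule ℂ (Form L 3)}
    (hS : ∀ k l m, frameForm α β γ ![e₀ k, e₁ l, e₂ m] ∈ S) {a b c : Form L 1}
    (ha : a ∈ Submodule.span ℂ (Set.range fun k ↦ frame α β γ (e₀ k)))
    (hb : b ∈ Submodule.span ℂ (Set.range fun k ↦ frame α β γ (e₁ k)))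
    (hc : c ∈ Submodule.span ℂ (Set.range fun k ↦ frame α β γ (e₂ k))) :
    a ⋏ b ⋏ c ∈ S := by
  rw [wedge_one_one_one]
  have := map_mem_span_of_mem_span (decomp (n := 3) (L := L)).toMultilinearMap
    (![fun k ↦ frame α β γ (e₀ k), fun k ↦ frame α β γ (e₁ k), fun k ↦ frame α β γ (e₂ k)])
    ![a, b, c] (by intro i; fin_cases i; exacts [ha, hb, hc])
  refine Submodule.span_le.2 ?_ this
  rintro _ ⟨s, rfl⟩
  have h : (fun i ↦ (![fun k ↦ frame α β γ (e₀ k), fun k ↦ frame α β γ (e₁ k),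
      fun k ↦ frame α β γ (e₂ k)] : Fin 3 → Fin 3 → Form L 1) i (s i)) =
      frame α β γ ∘ ![e₀ (s 0), e₁ (s 1), e₂ (s 2)] := by
    ext i : 1
    fin_cases i <;> rfl
  have h' := hS (s 0) (s 1) (s 2)
  rw [frameForm, ← h] at h'
  exact h'

theorem IsUnitaryCoframe.lambda21_le (h : IsUnitaryCoframe J α β γ)
    (hdim : Module.finrank ℝ L = 6) {S : Submodule ℂ (Form L 3)}
    (hS : ∀ k l m, frameForm α β γ ![lo k, lo l, hi m] ∈ S) : lambda21 J ≤ S := by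
  refine Submodule.span_le.2 ?_
  rintro _ ⟨a, b, c, ha, hb, hc, rfl⟩
  exact wedge_mem_of_frameForm_mem hS (h.mem_span_of_isOneZero hdim ha)
    (h.mem_span_of_isOneZero hdim hb) (h.conjForm_mem_span_of_isOneZero hdim hc)

theorem IsUnitaryCoframe.lambda30_le (h : IsUnitaryCoframe J α β γ)
    (hdim : Module.finrank ℝ L = 6) {S : Submodule ℂ (Form L 3)}
    (hS : ∀ k l m, frameForm α β γ ![lo k, lo l, lo m] ∈ S) : lambda30 J ≤ S := by
  refine Submodule.span_le.2 ?_
  rintro _ ⟨a, b, c, ha, hb, hc, rfl⟩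
  exact wedge_mem_of_frameForm_mem hS (h.mem_span_of_isOneZero hdim ha)
    (h.mem_span_of_isOneZero hdim hb) (h.mem_span_of_isOneZero hdim hc)

theorem IsUnitaryCoframe.lambda03_le (h : IsUnitaryCoframe J α β γ)
    (hdim : Module.finrank ℝ L = 6) {S : Submodule ℂ (Form L 3)}
    (hS : ∀ k l m, frameForm α β γ ![hi k, hi l, hi m] ∈ S) : lambda03 J ≤ S := by
  refine Submodule.span_le.2 ?_
  rintro _ ⟨a, b, c, ha, hb, hc, rfl⟩
  exact wedge_mem_of_frameForm_mem hS (h.conjForm_mem_span_of_isOneZero hdim ha)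
    (h.conjForm_mem_span_of_isOneZero hdim hb) (h.conjForm_mem_span_of_isOneZero hdim hc)

theorem IsUnitaryCoframe.omegaWedge_le (h : IsUnitaryCoframe J α β γ)
    (hdim : Module.finrank ℝ L = 6) {S : Submodule ℂ (Form L 3)}
    (hS : ∀ i, fundamentalForm J ⋏ frame α β γ i ∈ S) : omegaWedge J ≤ S := by
  refine Submodule.span_le.2 ?_
  rintro _ ⟨a, rfl⟩
  have : Submodule.span ℂ (Set.range (frame α β γ)) ≤
      S.comap (wedgeBilin 2 1 (fundamentalForm J)) := by
    refine Submodule.span_le.2 ?_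
    rintro _ ⟨i, rfl⟩
    exact hS i
  exact this (h.mem_span_frame hdim a)

theorem IsUnitaryCoframe.frameForm_mem_lambda30 (h : IsUnitaryCoframe J α β γ) (k l m : Fin 3) :
    frameForm α β γ ![lo k, lo l, lo m] ∈ lambda30 J :=
  Submodule.subset_span ⟨_, _, _, h.isOneZero_frame k, h.isOneZero_frame l, h.isOneZero_frame m,
    frameForm_three _ _ _ _ _ _⟩

theorem IsUnitaryCoframe.frameForm_mem_lambda03 (h : IsUnitaryCoframe J α β γ) (k l m : Fin 3) :
    frameForm α β γ ![hi k, hi l, hi m] ∈ lambda03 J :=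
  Submodule.subset_span ⟨_, _, _, h.isOneZero_frame k, h.isOneZero_frame l, h.isOneZero_frame m,
    by simp only [conjForm_frame, lo_add_three, frameForm_three]⟩

theorem IsUnitaryCoframe.frameForm_mem_lambda21 (h : IsUnitaryCoframe J α β γ) (k l m : Fin 3) :
    frameForm α β γ ![lo k, lo l, hi m] ∈ lambda21 J :=
  Submodule.subset_span ⟨_, _, _, h.isOneZero_frame k, h.isOneZero_frame l, h.isOneZero_frame m,
    by simp only [conjForm_frame, lo_add_three, frameForm_three]⟩

theorem IsUnitaryCoframe.eta_mem_lambda21 (h : IsUnitaryCoframe J α β γ) (i : Fin 6) :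
    eta α β γ i ∈ lambda21 J := by
  obtain ⟨k, l, m, h1⟩ := (by decide : ∀ i, ∃ k l m, etaFst i = ![lo k, lo l, hi m]) i
  obtain ⟨p, q, r, h2⟩ := (by decide : ∀ i, ∃ k l m, etaSnd i = ![lo k, lo l, hi m]) i
  rw [eta_eq, h1, h2]
  exact Submodule.sub_mem _ (h.frameForm_mem_lambda21 k l m) (h.frameForm_mem_lambda21 p q r)

/-- This makes $\omega^2\wedge\cdot$ injective on $(1,0)$-forms. The two orders of the remaining
pairs and the sign of $\alpha\bar\alpha\beta\bar\beta\gamma\bar\gamma$ against the volume form give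
$-2$, and $(i/2)^2\cdot(-2)=1/2$. -/
theorem IsUnitaryCoframe.fundamentalForm_wedge_wedge (h : IsUnitaryCoframe J α β γ)
    (k l : Fin 3) :
    (fundamentalForm J ⋏ (fundamentalForm J ⋏ frame α β γ (lo k))) ⋏ frame α β γ (hi l) =
      if k = l then (1 / 2 : ℂ) • decomp (frame α β γ) else 0 := by
  have hN : ∀ k l : Fin 3, ∑ p : Fin 3, ∑ q : Fin 3, mapSign (n := 6) (Fin.append
      (Fin.append ![lo q, hi q] (Fin.append ![lo p, hi p] ![lo k])) ![hi l]) =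
      if k = l then -2 else 0 := by decide +kernel
  have h6 : ∀ s : Fin (2 + (2 + 1) + 1) → Fin 6, frameForm α β γ s =
      mapSign (n := 6) s • decomp (frame α β γ) := fun s ↦ frameForm_six _ _ _ s
  rw [← frameForm_one, ← frameForm_one, h.fundamentalForm_wedge, wedge_smul, wedge_sum, smul_wedge,
    sum_wedge]
  simp only [h.fundamentalForm_wedge, smul_wedge, sum_wedge, frameForm_wedge, h6,
    ← Finset.smul_sum, ← Finset.sum_smul]
  rw [hN, smul_smul]
  split_ifs
  · rw [← Int.cast_smul_eq_zsmul ℂ, smul_smul]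
    congr 1
    push_cast
    linear_combination (-1 / 2 : ℂ) * Complex.I_mul_I
  · simp

/-- The forms `eta` span the effective `(2,1)`-forms. -/
theorem IsUnitaryCoframe.mem_span_eta_iff (h : IsUnitaryCoframe J α β γ)
    (hdim : Module.finrank ℝ L = 6) (φ : Form L 3) :
    φ ∈ Submodule.span ℂ (Set.range (eta α β γ)) ↔ IsEffective21 J φ := by
  have hle : Submodule.span ℂ (Set.range (eta α β γ)) ≤
      lambda21 J ⊓ LinearMap.ker (wedgeBilin 2 3 (fundamentalForm J)) := by
    refine Submodule.span_le.2 ?_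
    rintro _ ⟨i, rfl⟩
    exact ⟨h.eta_mem_lambda21 i, h.fundamentalForm_wedge_eta i⟩
  refine ⟨fun hφ ↦ hle hφ, fun ⟨hφ, hω⟩ ↦ ?_⟩
  -- A $(2,1)$-form is $e+\omega\wedge x$ with $e$ in the span of the $\eta_i$ and $x$ of type
  -- $(1,0)$. As $\omega\wedge e=0$, effectiveness gives $\omega^2\wedge x=0$, hence $x=0$.
  have h21 := h.lambda21_le hdim (h.frameForm_mem_of_eta_mem
    (Submodule.span ℂ (Set.range (eta α β γ)) ⊔
      Submodule.span ℂ (Set.range fun k ↦ fundamentalForm J ⋏ frame α β γ (lo k)))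
    (fun i ↦ Submodule.mem_sup_left (Submodule.subset_span ⟨i, rfl⟩))
    (fun k ↦ Submodule.mem_sup_right (Submodule.subset_span ⟨k, rfl⟩))) hφ
  obtain ⟨e, he, f, hf, rfl⟩ := Submodule.mem_sup.1 h21
  obtain ⟨x, rfl⟩ := Submodule.mem_span_range_iff_exists_fun ℂ |>.1 hf
  have he0 : fundamentalForm J ⋏ e = 0 := (hle he).2
  rw [wedge_add, he0, zero_add, wedge_sum] at hω
  have hx : ∀ l, x l = 0 := by
    intro l
    have := congrArg (fun ψ : Form L (2 + (2 + 1)) ↦ ψ ⋏ frame α β γ (hi l)) hω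
    simp only [sum_wedge, wedge_smul, smul_wedge, h.fundamentalForm_wedge_wedge] at this
    rw [zero_wedge] at this
    simpa [h.decomp_frame_ne_zero hdim] using this
  simpa [hx] using he

/-- The forms without effective component. -/
def nonEffective (J : OrthogonalACS g) : Submodule ℂ (Form L 3) :=
  lambda30 J ⊔ lambda03 J ⊔ omegaWedge J

/-- Products of $\eta_i$ with $(3,0)$- and $(0,3)$-forms have the impossible types $(5,1)$ and
$(2,4)$, and $\omega\wedge a\wedge\eta_i=0$ because $\omega\wedge\eta_i=0$. -/
theorem IsUnitaryCoframe.wedge_eta_eq_zero (h : IsUnitaryCoframe J α β γ)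
    (hdim : Module.finrank ℝ L = 6) {ρ : Form L 3} (hρ : ρ ∈ nonEffective J) (i : Fin 6) :
    ρ ⋏ eta α β γ i = 0 := by
  have hF : ∀ s : Fin 3 → Fin 6, frameForm α β γ s ⋏ eta α β γ i =
      pairing s ![0, 0, 3] (etaFst i) (etaSnd i) • decomp (frame α β γ) := fun s ↦ by
    have h0 : frameForm α β γ ![0, 0, 3] = 0 := frameForm_eq_zero _ _ _ _ (by decide)
    rw [← sub_wedge_sub_eq_pairing, h0, sub_zero, eta_eq]
  suffices nonEffective J ≤ LinearMap.ker ((wedgeBilin 3 3).flip (eta α β γ i)) from this hρ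
  refine sup_le (sup_le (h.lambda30_le hdim fun k l m ↦ ?_) (h.lambda03_le hdim fun k l m ↦ ?_))
    (h.omegaWedge_le hdim fun j ↦ ?_)
  · have : ∀ (k l m : Fin 3) (i : Fin 6),
        pairing ![lo k, lo l, lo m] ![0, 0, 3] (etaFst i) (etaSnd i) = 0 := by decide +kernel
    change _ ⋏ _ = 0
    rw [hF, this, zero_smul]
  · have : ∀ (k l m : Fin 3) (i : Fin 6),
        pairing ![hi k, hi l, hi m] ![0, 0, 3] (etaFst i) (etaSnd i) = 0 := by decide +kernel
    change _ ⋏ _ = 0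
    rw [hF, this, zero_smul]
  · have : ∀ (j i : Fin 6), pairing ![0, 3, j] ![0, 0, 3] (etaFst i) (etaSnd i) +
        pairing ![1, 4, j] ![0, 0, 3] (etaFst i) (etaSnd i) +
        pairing ![2, 5, j] ![0, 0, 3] (etaFst i) (etaSnd i) = 0 := by decide +kernel
    change _ ⋏ _ = 0
    rw [h.fundamentalForm_wedge_frame, smul_wedge, add_wedge, add_wedge, hF, hF, hF, ← add_smul,
      ← add_smul, this, zero_smul, smul_zero]

theorem conjForm_mem_nonEffective {ρ : Form L 3} (hρ : ρ ∈ nonEffective J) :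
    conjForm ρ ∈ nonEffective J := by
  suffices nonEffective J ≤ (nonEffective J).comap (conjFormLin 3) from this hρ
  refine sup_le (sup_le ?_ ?_) ?_ <;> refine Submodule.span_le.2 ?_
  · rintro _ ⟨a, b, c, ha, hb, hc, rfl⟩
    refine Submodule.mem_sup_left (Submodule.mem_sup_right
      (Submodule.subset_span ⟨a, b, c, ha, hb, hc, ?_⟩))
    rw [conjFormLin_apply, conjForm_wedge, conjForm_wedge]
  · rintro _ ⟨a, b, c, ha, hb, hc, rfl⟩
    refine Submodule.mem_sup_left (Submodule.mem_sup_left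
      (Submodule.subset_span ⟨a, b, c, ha, hb, hc, ?_⟩))
    rw [conjFormLin_apply, conjForm_wedge, conjForm_wedge, conjForm_conjForm, conjForm_conjForm,
      conjForm_conjForm]
  · rintro _ ⟨a, rfl⟩
    refine Submodule.mem_sup_right (Submodule.subset_span ⟨conjForm a, ?_⟩)
    rw [conjFormLin_apply, conjForm_wedge, conjForm_fundamentalForm]

/-- Each frame product of three members has a pure type. Mixed types are rotated, an even
permutation, until the odd member stands last; then `IsUnitaryCoframe.frameForm_mem_of_eta_mem` or
its conjugate applies. -/
theorem IsUnitaryCoframe.sup_eq_top (h : IsUnitaryCoframe J α β γ)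
    (hdim : Module.finrank ℝ L = 6) :
    nonEffective J ⊔ (Submodule.span ℂ (Set.range (eta α β γ)) ⊔
      Submodule.span ℂ (Set.range fun i ↦ conjForm (eta α β γ i))) = ⊤ := by
  set S := nonEffective J ⊔ (Submodule.span ℂ (Set.range (eta α β γ)) ⊔
      Submodule.span ℂ (Set.range fun i ↦ conjForm (eta α β γ i))) with hS
  have hR : nonEffective J ≤ S := le_sup_left
  have hω : ∀ a : Form L 1, fundamentalForm J ⋏ a ∈ S := fun a ↦
    hR (Submodule.mem_sup_right (Submodule.subset_span ⟨a, rfl⟩))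
  have hη : ∀ i, eta α β γ i ∈ S := fun i ↦
    Submodule.mem_sup_right (Submodule.mem_sup_left (Submodule.subset_span ⟨i, rfl⟩))
  have hη' : ∀ i, conjForm (eta α β γ i) ∈ S := fun i ↦
    Submodule.mem_sup_right (Submodule.mem_sup_right (Submodule.subset_span ⟨i, rfl⟩))
  have h30 : ∀ k l m, frameForm α β γ ![lo k, lo l, lo m] ∈ S := fun k l m ↦
    hR (Submodule.mem_sup_left (Submodule.mem_sup_left (h.frameForm_mem_lambda30 k l m)))
  have h03 : ∀ k l m, frameForm α β γ ![hi k, hi l, hi m] ∈ S := fun k l m ↦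
    hR (Submodule.mem_sup_left (Submodule.mem_sup_right (h.frameForm_mem_lambda03 k l m)))
  have h21 : ∀ k l m, frameForm α β γ ![lo k, lo l, hi m] ∈ S :=
    h.frameForm_mem_of_eta_mem S hη fun k ↦ hω _
  have h12 : ∀ k l m, frameForm α β γ ![hi k, hi l, lo m] ∈ S := fun k l m ↦ by
    -- Type $(1,2)$ is type $(2,1)$ for the preimage of `S` under conjugation, which contains the
    -- $\eta_i$ because `S` contains the $\bar\eta_i$.
    have := h.frameForm_mem_of_eta_mem (S.comap (conjFormLin 3)) hη' (fun k ↦ by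
      rw [Submodule.mem_comap, conjFormLin_apply, conjForm_wedge, conjForm_fundamentalForm]
      exact hω _) k l m
    rw [Submodule.mem_comap, conjFormLin_apply, conjForm_frameForm] at this
    convert this using 2
    ext p : 1
    fin_cases p
    exacts [(lo_add_three k).symm, (lo_add_three l).symm, (hi_add_three m).symm]
  have hrot : ∀ i j k : Fin 6, frameForm α β γ ![i, j, k] ∈ S →
      frameForm α β γ ![j, k, i] ∈ S := fun i j k hS ↦ by
    rwa [frameForm_rotate]
  rw [eq_top_iff, ← h.span_decomp_eq_top hdim 3]
  refine Submodule.span_le.2 ?_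
  rintro _ ⟨s, rfl⟩
  change frameForm α β γ s ∈ S
  obtain ⟨i, j, k, rfl⟩ : ∃ i j k, s = ![i, j, k] :=
    ⟨s 0, s 1, s 2, by ext p; fin_cases p <;> rfl⟩
  rcases exists_lo_or_hi i with ⟨i, rfl⟩ | ⟨i, rfl⟩ <;>
  rcases exists_lo_or_hi j with ⟨j, rfl⟩ | ⟨j, rfl⟩ <;>
  rcases exists_lo_or_hi k with ⟨k, rfl⟩ | ⟨k, rfl⟩
  · exact h30 i j k
  · exact h21 i j k
  · exact hrot _ _ _ (h21 k i j)
  · exact hrot _ _ _ (hrot _ _ _ (h12 j k i))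
  · exact hrot _ _ _ (hrot _ _ _ (h21 j k i))
  · exact hrot _ _ _ (h12 k i j)
  · exact h12 i j k
  · exact h03 i j k

/-- A real 3-form is the sum of a form without effective component and of its effective
components. -/
theorem IsUnitaryCoframe.exists_eq_add_sum (h : IsUnitaryCoframe J α β γ)
    (hdim : Module.finrank ℝ L = 6) {φ : Form L 3} (hφ : conjForm φ = φ) :
    ∃ ρ ∈ nonEffective J, ∃ c : Fin 6 → ℂ, φ = ρ + ∑ i, (c i • conjForm (eta α β γ i) +
      (starRingEnd ℂ) (c i) • eta α β γ i) := by
  have hmem : φ ∈ nonEffective J ⊔ (Submodule.span ℂ (Set.range (eta α β γ)) ⊔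
      Submodule.span ℂ (Set.range fun i ↦ conjForm (eta α β γ i))) := by
    rw [h.sup_eq_top hdim]; trivial
  obtain ⟨r, hr, f, hf, rfl⟩ := Submodule.mem_sup.1 hmem
  obtain ⟨e, he, e', he', rfl⟩ := Submodule.mem_sup.1 hf
  obtain ⟨b, rfl⟩ := Submodule.mem_span_range_iff_exists_fun ℂ |>.1 he
  obtain ⟨a, rfl⟩ := Submodule.mem_span_range_iff_exists_fun ℂ |>.1 he'
  -- Averaging an arbitrary decomposition of the real form with its conjugate makes the coefficients
  -- of $\eta_i$ and $\bar\eta_i$ conjugate.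
  refine ⟨(1 / 2 : ℂ) • (r + conjForm r), Submodule.smul_mem _ _ (Submodule.add_mem _ hr
    (conjForm_mem_nonEffective hr)), fun i ↦ (1 / 2 : ℂ) * (a i + (starRingEnd ℂ) (b i)), ?_⟩
  have hc : conjForm (r + (∑ i, b i • eta α β γ i + ∑ i, a i • conjForm (eta α β γ i))) =
      conjForm r + (∑ i, (starRingEnd ℂ) (b i) • conjForm (eta α β γ i) +
        ∑ i, (starRingEnd ℂ) (a i) • eta α β γ i) := by
    simp only [← conjFormLin_apply, map_add, map_sum, map_smulₛₗ]
    simp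
  rw [hc] at hφ
  have hhalf : ∀ x y : Form L 3, y = x → x = (1 / 2 : ℂ) • (x + y) := by
    rintro x _ rfl; module
  rw [hhalf _ _ hφ]
  simp only [map_mul, map_add, Complex.conj_conj, mul_smul, add_smul, smul_add,
    Finset.sum_add_distrib, Finset.smul_sum]
  simp only [map_div₀, map_one, map_ofNat]
  abel

theorem IsUnitaryCoframe.add_sum_wedge_eta (h : IsUnitaryCoframe J α β γ)
    (hdim : Module.finrank ℝ L = 6) {ρ : Form L 3} (hρ : ρ ∈ nonEffective J) (c : Fin 6 → ℂ)
    (i : Fin 6) :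
    (ρ + ∑ j, (c j • conjForm (eta α β γ j) + (starRingEnd ℂ) (c j) • eta α β γ j)) ⋏
      eta α β γ i = c i • (conjForm (eta α β γ i) ⋏ eta α β γ i) := by
  rw [add_wedge, h.wedge_eta_eq_zero hdim hρ, zero_add, sum_wedge, Finset.sum_eq_single i]
  · rw [add_wedge, smul_wedge, smul_wedge, eta_wedge_eta, smul_zero, add_zero]
  · intro j _ hj
    rw [add_wedge, smul_wedge, smul_wedge, eta_wedge_eta, conj_eta_wedge_eta_of_ne _ _ _ hj,
      smul_zero, smul_zero, add_zero]
  · simp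

end Hermitian

/-! ### Forms of type (3,0)+(0,3), and cyclic sums on the Gray–Hervella components -/

section ThreeForms

variable {L : Type*} [AddCommGroup L] [Module ℝ L]

theorem form_swap_left (φ : Form L 3) (X Y Z : L) : φ ![X, Y, Z] = -φ ![Y, X, Z] := by
  rw [← φ.map_swap ![Y, X, Z] (i := 0) (j := 1) (by decide)]
  congr 1
  ext j
  fin_cases j <;> rfl

theorem form_swap_right (φ : Form L 3) (X Y Z : L) : φ ![X, Y, Z] = -φ ![X, Z, Y] := by
  rw [← φ.map_swap ![X, Z, Y] (i := 1) (j := 2) (by decide)]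
  congr 1
  ext j
  fin_cases j <;> rfl

theorem form_add_left (φ : Form L 3) (X X' Y Z : L) :
    φ ![X + X', Y, Z] = φ ![X, Y, Z] + φ ![X', Y, Z] := φ.map_vecCons_add ![Y, Z] X X'

theorem form_add_mid (φ : Form L 3) (X Y Y' Z : L) :
    φ ![X, Y + Y', Z] = φ ![X, Y, Z] + φ ![X, Y', Z] :=
  (φ.curryLeft X).map_vecCons_add ![Z] Y Y'

theorem form_add_right (φ : Form L 3) (X Y Z Z' : L) :
    φ ![X, Y, Z + Z'] = φ ![X, Y, Z] + φ ![X, Y, Z'] :=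
  ((φ.curryLeft X).curryLeft Y).map_vecCons_add ![] Z Z'

theorem form_smul_left (φ : Form L 3) (t : ℝ) (X Y Z : L) :
    φ ![t • X, Y, Z] = t * φ ![X, Y, Z] := φ.map_vecCons_smul ![Y, Z] t X

theorem form_smul_mid (φ : Form L 3) (t : ℝ) (X Y Z : L) :
    φ ![X, t • Y, Z] = t * φ ![X, Y, Z] := (φ.curryLeft X).map_vecCons_smul ![Z] t Y

theorem form_smul_right (φ : Form L 3) (t : ℝ) (X Y Z : L) :
    φ ![X, Y, t • Z] = t * φ ![X, Y, Z] :=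
  ((φ.curryLeft X).curryLeft Y).map_vecCons_smul ![] t Z

/-- The real part of a 3-form as a tensor. -/
def reTensor (φ : Form L 3) : Tensor₃ L :=
  LinearMap.mk₂ ℝ
    (fun X Y ↦
      { toFun := fun Z ↦ (φ ![X, Y, Z]).re
        map_add' := fun Z Z' ↦ by rw [form_add_right, Complex.add_re]
        map_smul' := fun t Z ↦ by rw [form_smul_right, Complex.re_ofReal_mul]; rfl })
    (fun X X' Y ↦ by ext Z; simp [form_add_left])
    (fun t X Y ↦ by ext Z; simp [form_smul_left])
    (fun X Y Y' ↦ by ext Z; simp [form_add_mid])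
    (fun t X Y ↦ by ext Z; simp [form_smul_mid])

@[simp] theorem reTensor_apply (φ : Form L 3) (X Y Z : L) :
    reTensor φ X Y Z = (φ ![X, Y, Z]).re := rfl

theorem decomp_three_apply (a b c : Form L 1) (X Y Z : L) :
    decomp ![a, b, c] ![X, Y, Z] =
      a ![X] * b ![Y] * c ![Z] - a ![X] * b ![Z] * c ![Y] - a ![Y] * b ![X] * c ![Z] +
      a ![Y] * b ![Z] * c ![X] + a ![Z] * b ![X] * c ![Y] - a ![Z] * b ![Y] * c ![X] := by
  rw [decomp_apply, Matrix.det_fin_three]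
  simp

theorem wedge_wedge_apply (a b c : Form L 1) (X Y Z : L) :
    (a ⋏ b ⋏ c) ![X, Y, Z] = (a ⋏ b) ![X, Y] * c ![Z] - (a ⋏ b) ![X, Z] * c ![Y] +
      (a ⋏ b) ![Y, Z] * c ![X] := by
  have h2 : ∀ X Y : L, (a ⋏ b) ![X, Y] = a ![X] * b ![Y] - a ![Y] * b ![X] := fun X Y ↦ by
    rw [wedge_one_one, decomp_apply, Matrix.det_fin_two]
    simp
  rw [wedge_one_one_one, decomp_three_apply, h2, h2, h2]
  ring

/-- A real linear functional as a complex 1-form. -/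
def dualForm (θ : Module.Dual ℝ L) : Form L 1 :=
  AlternatingMap.ofSubsingleton ℝ L ℂ 0 (Complex.ofRealCLM.toLinearMap ∘ₗ θ)

@[simp] theorem dualForm_apply (θ : Module.Dual ℝ L) (X : L) : dualForm θ ![X] = (θ X : ℂ) := rfl

variable {g : InvariantMetric L} {J : OrthogonalACS g} {α β γ : Form L 1}

theorem fundamentalForm_apply (X Y : L) :
    fundamentalForm J ![X, Y] = ((g.form (J.map X) Y : ℝ) : ℂ) := rfl

theorem form_apply_map (X Y : L) : g.form X (J.map Y) = -g.form (J.map X) Y := by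
  rw [← J.orth X, J.sq, map_neg]

theorem form_map_swap (X Y : L) : g.form (J.map Y) X = -g.form (J.map X) Y := by
  rw [g.symm, form_apply_map]

theorem IsUnitaryCoframe.fundamentalForm_wedge_apply (h : IsUnitaryCoframe J α β γ)
    (a : Form L 1) (X Y Z : L) : (fundamentalForm J ⋏ a) ![X, Y, Z] =
      g.form (J.map X) Y * a ![Z] - g.form (J.map X) Z * a ![Y] + g.form (J.map Y) Z * a ![X] := by
  rw [← fundamentalForm_apply, ← fundamentalForm_apply, ← fundamentalForm_apply, h.fundamental,
    smul_wedge, add_wedge, add_wedge]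
  simp only [AlternatingMap.smul_apply, AlternatingMap.add_apply, smul_eq_mul]
  rw [wedge_wedge_apply, wedge_wedge_apply, wedge_wedge_apply]
  ring

/-- The 3-forms `φ` with `φ(X, JY, JZ) = -φ(X, Y, Z)`. -/
def skewTypeForms (J : OrthogonalACS g) : Submodule ℂ (Form L 3) where
  carrier := {φ | ∀ X Y Z, φ ![X, J.map Y, J.map Z] = -φ ![X, Y, Z]}
  zero_mem' := by simp
  add_mem' {φ ψ} hφ hψ X Y Z := by
    simp only [AlternatingMap.add_apply, hφ X Y Z, hψ X Y Z]; ring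
  smul_mem' c φ hφ X Y Z := by
    simp only [AlternatingMap.smul_apply, hφ X Y Z, smul_neg]

/-- Inserting $J$ in two slots multiplies a $(3,0)$-form by $i^2$ and a $(0,3)$-form by $(-i)^2$. -/
theorem sup_le_skewTypeForms : lambda30 J ⊔ lambda03 J ≤ skewTypeForms J := by
  refine sup_le (Submodule.span_le.2 ?_) (Submodule.span_le.2 ?_)
  · rintro _ ⟨a, b, c, ha, hb, hc, rfl⟩ X Y Z
    rw [wedge_one_one_one, decomp_three_apply, decomp_three_apply, ha, ha, hb, hb, hc, hc]
    ring_nf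
    rw [Complex.I_sq]
    ring
  · rintro _ ⟨a, b, c, ha, hb, hc, rfl⟩ X Y Z
    rw [wedge_one_one_one, decomp_three_apply, decomp_three_apply]
    simp only [conjForm_apply, ha _, hb _, hc _, map_mul, Complex.conj_I]
    ring_nf
    rw [Complex.I_sq]
    ring

/-- Pull-back of 3-forms. -/
def pullback (f : L →ₗ[ℝ] L) : Form L 3 →ₗ[ℂ] Form L 3 where
  toFun φ := φ.compLinearMap f
  map_add' _ _ := rfl
  map_smul' _ _ := rfl

/-- The projection to the forms of type `(3,0) + (0,3)`. -/
def skewTypeProj (J : OrthogonalACS g) : Form L 3 →ₗ[ℂ] Form L 3 :=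
  (1 / 8 : ℂ) • ((4 : ℂ) • LinearMap.id - pullback (LinearMap.id + (1 : ℝ) • J.map) -
    pullback (LinearMap.id + (-1 : ℝ) • J.map))

theorem pullback_apply (φ : Form L 3) (t : ℝ) (X Y Z : L) :
    pullback (LinearMap.id + t • J.map) φ ![X, Y, Z] = φ ![X, Y, Z] +
      t * (φ ![J.map X, Y, Z] + φ ![X, J.map Y, Z] + φ ![X, Y, J.map Z]) +
      t ^ 2 * (φ ![X, J.map Y, J.map Z] + φ ![J.map X, Y, J.map Z] + φ ![J.map X, J.map Y, Z]) +
      t ^ 3 * φ ![J.map X, J.map Y, J.map Z] := by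
  have : pullback (LinearMap.id + t • J.map) φ ![X, Y, Z] =
      φ ![X + t • J.map X, Y + t • J.map Y, Z + t • J.map Z] := by
    change φ _ = φ _
    congr 1
    ext i
    fin_cases i <;> rfl
  rw [this]
  simp only [form_add_left, form_add_mid, form_add_right, form_smul_left, form_smul_mid,
    form_smul_right]
  ring

/-- In the sum of the pull-backs by $1\pm J$ the odd terms cancel, leaving $2(\varphi+Q)$, where $Q$
collects the three insertions of $J$ in two slots. Here $Q=-3\varphi$, so the projection gives
$(4+4)\varphi/8=\varphi$. -/
theorem skewTypeProj_of_mem {φ : Form L 3} (hφ : φ ∈ skewTypeForms J) :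
    skewTypeProj J φ = φ := by
  ext v
  obtain ⟨X, Y, Z, rfl⟩ : ∃ X Y Z, v = ![X, Y, Z] :=
    ⟨v 0, v 1, v 2, by ext i; fin_cases i <;> rfl⟩
  have h1 := hφ X Y Z
  have h2 : ∀ Y Z, φ ![J.map X, Y, J.map Z] = -φ ![X, Y, Z] := fun Y Z ↦ by
    rw [form_swap_left, hφ Y X Z, form_swap_left φ Y X Z, neg_neg]
  have h3 : φ ![J.map X, J.map Y, Z] = -φ ![X, Y, Z] := by
    rw [form_swap_right, h2, form_swap_right φ X Z Y, neg_neg]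
  change (1 / 8 : ℂ) * (4 * φ ![X, Y, Z] - pullback (LinearMap.id + (1 : ℝ) • J.map) φ ![X, Y, Z] -
    pullback (LinearMap.id + (-1 : ℝ) • J.map) φ ![X, Y, Z]) = _
  rw [pullback_apply, pullback_apply, h1, h2, h3]
  push_cast
  ring

/-- The eigenvalues of `J` on the frame. -/
def frameEigenvalue : Fin 6 → ℂ := Fin.append (fun _ : Fin 3 ↦ Complex.I) fun _ : Fin 3 ↦ -Complex.I

@[simp] theorem frameEigenvalue_lo (k : Fin 3) : frameEigenvalue (lo k) = Complex.I :=
  Fin.append_left _ _ k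

@[simp] theorem frameEigenvalue_hi (k : Fin 3) : frameEigenvalue (hi k) = -Complex.I :=
  Fin.append_right _ _ k

theorem IsUnitaryCoframe.frame_map (h : IsUnitaryCoframe J α β γ) (i : Fin 6) (X : L) :
    frame α β γ i ![J.map X] = frameEigenvalue i * frame α β γ i ![X] := by
  rcases exists_lo_or_hi i with ⟨k, rfl⟩ | ⟨k, rfl⟩
  · rw [h.isOneZero_frame k X, frameEigenvalue_lo]
  · rw [h.frame_hi_apply, frameEigenvalue_hi]

theorem IsUnitaryCoframe.pullback_frameForm (h : IsUnitaryCoframe J α β γ) (t : ℝ)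
    (s : Fin 3 → Fin 6) : pullback (LinearMap.id + t • J.map) (frameForm α β γ s) =
      (∏ i, (1 + t * frameEigenvalue (s i))) • frameForm α β γ s := by
  change (decomp (frame α β γ ∘ s)).compLinearMap _ = _
  rw [decomp_compLinearMap, frameForm]
  change _ = _ • decomp.toMultilinearMap _
  rw [← MultilinearMap.map_smul_univ]
  change decomp _ = decomp _
  congr 1
  ext i v
  obtain ⟨X, rfl⟩ : ∃ X, v = ![X] := ⟨v 0, by ext i; fin_cases i; rfl⟩
  have : (fun i ↦ (LinearMap.id + t • J.map : L →ₗ[ℝ] L) (![X] i)) = ![X + t • J.map X] := by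
    ext i; fin_cases i; rfl
  simp only [Function.comp_apply, AlternatingMap.compLinearMap_apply, AlternatingMap.smul_apply,
    smul_eq_mul]
  change frame α β γ (s i) (fun i ↦ (LinearMap.id + t • J.map : L →ₗ[ℝ] L) (![X] i)) = _
  rw [this, ← oneFormLin_apply, map_add, map_smul, oneFormLin_apply, oneFormLin_apply,
    h.frame_map, Complex.real_smul]
  ring

theorem IsUnitaryCoframe.skewTypeProj_mem (h : IsUnitaryCoframe J α β γ)
    (hdim : Module.finrank ℝ L = 6) (φ : Form L 3) :
    skewTypeProj J φ ∈ lambda30 J ⊔ lambda03 J := by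
  suffices (⊤ : Submodule ℂ (Form L 3)) ≤
    (lambda30 J ⊔ lambda03 J).comap (skewTypeProj J) from this trivial
  rw [← h.span_decomp_eq_top hdim 3]
  refine Submodule.span_le.2 ?_
  rintro _ ⟨s, rfl⟩
  change skewTypeProj J (frameForm α β γ s) ∈ lambda30 J ⊔ lambda03 J
  have hs : skewTypeProj J (frameForm α β γ s) = ((1 / 8 : ℂ) *
      (4 - ∏ i, (1 + frameEigenvalue (s i)) - ∏ i, (1 - frameEigenvalue (s i)))) •
        frameForm α β γ s := by
    simp only [skewTypeProj, LinearMap.smul_apply, LinearMap.sub_apply, LinearMap.id_apply,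
      h.pullback_frameForm, ← sub_smul, smul_smul]
    congr 3
    · simp
    · simp [sub_eq_add_neg]
  rw [hs]
  obtain ⟨i, j, k, rfl⟩ : ∃ i j k, s = ![i, j, k] :=
    ⟨s 0, s 1, s 2, by ext p; fin_cases p <;> rfl⟩
  have hz : ∀ c : ℂ, c = 0 → c • frameForm α β γ ![i, j, k] ∈ lambda30 J ⊔ lambda03 J := by
    rintro _ rfl
    rw [zero_smul]
    exact Submodule.zero_mem _
  rcases exists_lo_or_hi i with ⟨i, rfl⟩ | ⟨i, rfl⟩ <;>
  rcases exists_lo_or_hi j with ⟨j, rfl⟩ | ⟨j, rfl⟩ <;>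
  rcases exists_lo_or_hi k with ⟨k, rfl⟩ | ⟨k, rfl⟩
  · exact Submodule.smul_mem _ _ (Submodule.mem_sup_left (h.frameForm_mem_lambda30 i j k))
  -- Seven cases remain after type $(3,0)$, and the last is $(0,3)$. For the mixed types the
  -- coefficient vanishes because $(1+i)^2(1-i)+(1-i)^2(1+i)=4$.
  on_goal 7 =>
    exact Submodule.smul_mem _ _ (Submodule.mem_sup_right (h.frameForm_mem_lambda03 i j k))
  all_goals
    refine hz _ ?_
    rw [Fin.prod_univ_three, Fin.prod_univ_three]
    change (1 / 8 : ℂ) * (4 - (1 + frameEigenvalue _) * (1 + frameEigenvalue _) *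
      (1 + frameEigenvalue _) - (1 - frameEigenvalue _) * (1 - frameEigenvalue _) *
      (1 - frameEigenvalue _)) = 0
    simp only [Matrix.cons_val_zero, Matrix.cons_val_one, Matrix.cons_val,
      frameEigenvalue_lo, frameEigenvalue_hi]
    linear_combination (1 / 4 : ℂ) * Complex.I_sq

theorem IsUnitaryCoframe.mem_sup_of_mem_skewTypeForms (h : IsUnitaryCoframe J α β γ)
    (hdim : Module.finrank ℝ L = 6) {φ : Form L 3} (hφ : φ ∈ skewTypeForms J) :
    φ ∈ lambda30 J ⊔ lambda03 J := by
  rw [← skewTypeProj_of_mem hφ]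
  exact h.skewTypeProj_mem hdim φ

theorem reTensor_mem_W₁ {φ : Form L 3} (hφ : φ ∈ skewTypeForms J) : reTensor φ ∈ W₁ J := by
  refine ⟨⟨fun X Y Z ↦ ?_, fun X Y Z ↦ ?_⟩, fun X Z ↦ ?_⟩
  · rw [reTensor_apply, form_swap_right, Complex.neg_re, reTensor_apply]
  · rw [reTensor_apply, hφ X Y Z, Complex.neg_re, reTensor_apply]
  · rw [reTensor_apply, φ.map_eq_zero_of_eq ![X, X, Z] (i := 0) (j := 1) rfl (by decide),
      Complex.zero_re]

/-- The element of `W₄` with parameter `θ`. -/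
def w₄Tensor (J : OrthogonalACS g) (θ : Module.Dual ℝ L) : Tensor₃ L :=
  LinearMap.mk₂ ℝ
    (fun X Y ↦ g.form X Y • θ - θ Y • g.form X - g.form X (J.map Y) • (θ ∘ₗ J.map) +
      θ (J.map Y) • (g.form X ∘ₗ J.map))
    (fun X X' Y ↦ by ext Z; simp; ring)
    (fun t X Y ↦ by ext Z; simp; ring)
    (fun X Y Y' ↦ by ext Z; simp; ring)
    (fun t X Y ↦ by ext Z; simp; ring)

theorem w₄Tensor_apply (θ : Module.Dual ℝ L) (X Y Z : L) :
    w₄Tensor J θ X Y Z = g.form X Y * θ Z - g.form X Z * θ Y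
      - g.form X (J.map Y) * θ (J.map Z) + g.form X (J.map Z) * θ (J.map Y) := by
  change g.form X Y * θ Z - θ Y * g.form X Z - g.form X (J.map Y) * θ (J.map Z) +
    θ (J.map Y) * g.form X (J.map Z) = _
  ring

theorem w₄Tensor_mem (θ : Module.Dual ℝ L) : w₄Tensor J θ ∈ W₄ J := by
  refine ⟨⟨fun X Y Z ↦ ?_, fun X Y Z ↦ ?_⟩, θ, w₄Tensor_apply θ⟩
  · rw [w₄Tensor_apply, w₄Tensor_apply]
    ring
  · rw [w₄Tensor_apply, w₄Tensor_apply]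
    simp only [J.sq, map_neg]
    ring

/-- The cyclic sum of an element of `W₄` is `2 ω ∧ (θ ∘ J)`. -/
theorem cyclicSum_of_W₄ {T : Tensor₃ L} {θ : Module.Dual ℝ L}
    (hT : ∀ X Y Z, T X Y Z = g.form X Y * θ Z - g.form X Z * θ Y
      - g.form X (J.map Y) * θ (J.map Z) + g.form X (J.map Z) * θ (J.map Y)) (X Y Z : L) :
    T X Y Z + T Y Z X + T Z X Y = 2 * (g.form (J.map X) Y * θ (J.map Z) -
      g.form (J.map X) Z * θ (J.map Y) + g.form (J.map Y) Z * θ (J.map X)) := by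
  rw [hT, hT, hT, g.symm Y X, g.symm Z X, g.symm Z Y]
  simp only [form_apply_map]
  rw [form_map_swap X Y, form_map_swap X Z, form_map_swap Y Z]
  ring

/-- Polarising $T(X,X,Z)=0$ makes $T$ totally skew, hence invariant under cyclic permutations. -/
theorem cyclicSum_of_W₁ {T : Tensor₃ L} (hT : T ∈ W₁ J) (X Y Z : L) :
    T X Y Z + T Y Z X + T Z X Y = 3 * T X Y Z := by
  have hl : ∀ X Y Z, T X Y Z = -T Y X Z := fun X Y Z ↦ by
    have := hT.2 (X + Y) Z
    simp only [map_add, LinearMap.add_apply, hT.2] at this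
    linarith
  have hr := hT.1.1
  have h1 : T Y Z X = T X Y Z := by rw [hr, hl Y X Z, neg_neg]
  have h2 : T Z X Y = T X Y Z := by rw [hl, hr X Z Y, neg_neg]
  rw [h1, h2]
  ring

/-- $T-T_1-T_4$ stays in $\mathcal W$ and has zero cyclic sum, which is membership in $\mathcal
W_2$. -/
theorem mem_sup_of_cyclicSum_eq {T T₁ T₄ : Tensor₃ L} (hT : T ∈ grayHervellaSpace J)
    (h1 : T₁ ∈ W₁ J) (h4 : T₄ ∈ W₄ J)
    (hsum : ∀ X Y Z, T X Y Z + T Y Z X + T Z X Y =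
      T₁ X Y Z + T₁ Y Z X + T₁ Z X Y + (T₄ X Y Z + T₄ Y Z X + T₄ Z X Y)) :
    T ∈ W₁ J ⊔ W₂ J ⊔ W₄ J := by
  have hG : T + (-1 : ℝ) • (T₁ + T₄) ∈ grayHervellaSpace J :=
    Submodule.add_mem _ hT (Submodule.smul_mem _ _ (Submodule.add_mem _ h1.1 h4.1))
  have h2 : T + (-1 : ℝ) • (T₁ + T₄) ∈ W₂ J := by
    refine ⟨hG, fun X Y Z ↦ ?_⟩
    simp only [LinearMap.add_apply, LinearMap.smul_apply, smul_eq_mul]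
    linear_combination hsum X Y Z
  have : T = T₁ + (T + (-1 : ℝ) • (T₁ + T₄)) + T₄ := by
    ext X Y Z
    simp only [LinearMap.add_apply, LinearMap.smul_apply, smul_eq_mul]
    ring
  rw [this]
  exact Submodule.add_mem_sup (Submodule.add_mem_sup h1 h2) h4

end ThreeForms

/-! ### The exterior derivative of ω and the class $\mathcal Z_{124}$ -/

section LieAlgebra

variable {L : Type*} [LieRing L] [LieAlgebra ℝ L] [FiniteDimensional ℝ L]
  {g : InvariantMetric L} (J : OrthogonalACS g)

/-- Skewness in the last two slots comes from that of $\omega$; the second symmetry combines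
metricity of $\nabla$ with $J^2=-1$ and orthogonality of $J$. -/
theorem nablaOmega_mem_grayHervellaSpace : nablaOmega J ∈ grayHervellaSpace J := by
  have hm : ∀ X Y Z, g.form (leviCivita g X Y) Z = -g.form Y (leviCivita g X Z) := fun X Y Z ↦ by
    linarith [leviCivita_metric g X Y Z]
  refine ⟨fun X Y Z ↦ ?_, fun X Y Z ↦ ?_⟩
  · rw [nablaOmega_apply, nablaOmega_apply, form_map_swap Z (leviCivita g X Y),
      form_map_swap (leviCivita g X Z) Y]
    ring
  · rw [nablaOmega_apply, nablaOmega_apply, J.orth, J.sq, hm X (J.map Y) Z, map_neg,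
      LinearMap.neg_apply]
    linarith [hm X Y (J.map Z), form_apply_map (J := J) (leviCivita g X Y) Z]

/-- `dω` is the cyclic sum of `∇ω`. -/
theorem extDeriv₂_fundamentalForm_apply (X Y Z : L) :
    extDeriv₂ (fundamentalForm J) ![X, Y, Z] =
      ((nablaOmega J X Y Z + nablaOmega J Y Z X + nablaOmega J Z X Y : ℝ) : ℂ) := by
  change -((g.form (J.map ⁅X, Y⁆) Z : ℝ) : ℂ) + ((g.form (J.map ⁅X, Z⁆) Y : ℝ) : ℂ) -
    ((g.form (J.map ⁅Y, Z⁆) X : ℝ) : ℂ) = _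
  have hn : ∀ X Y Z, nablaOmega J X Y Z = -g.form (J.map (leviCivita g X Y)) Z +
      g.form (J.map (leviCivita g X Z)) Y := fun X Y Z ↦ by
    rw [nablaOmega_apply, form_map_swap Y (leviCivita g X Z)]
    ring
  rw [hn, hn, hn, ← leviCivita_torsionFree g X Y, ← leviCivita_torsionFree g X Z,
    ← leviCivita_torsionFree g Y Z]
  simp only [map_sub, LinearMap.sub_apply]
  push_cast
  ring

theorem conjForm_extDeriv₂_fundamentalForm :
    conjForm (extDeriv₂ (fundamentalForm J)) = extDeriv₂ (fundamentalForm J) := by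
  ext v
  obtain ⟨X, Y, Z, rfl⟩ : ∃ X Y Z, v = ![X, Y, Z] :=
    ⟨v 0, v 1, v 2, by ext i; fin_cases i <;> rfl⟩
  rw [conjForm_apply, extDeriv₂_fundamentalForm_apply, Complex.conj_ofReal]

variable {J} {α β γ : Form L 1}

/-- `J` is in the class `W₁ ⊕ W₂ ⊕ W₄` if and only if `dω` has no effective component. -/
theorem IsUnitaryCoframe.mem_Z124_iff (h : IsUnitaryCoframe J α β γ)
    (hdim : Module.finrank ℝ L = 6) :
    J ∈ Z124 g ↔ extDeriv₂ (fundamentalForm J) ∈ nonEffective J := by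
  constructor
  · intro hJ
    obtain ⟨T, hT, T₄, ⟨-, θ, h4⟩, hsum⟩ := Submodule.mem_sup.1 hJ
    obtain ⟨T₁, h1, T₂, h2, rfl⟩ := Submodule.mem_sup.1 hT
    -- The $\mathcal W_2$ part has no cyclic sum and the $\mathcal W_4$ part gives the subtracted
    -- multiple of $\omega$, so only $3T_1$ is left.
    have hψ : ∀ X Y Z, (extDeriv₂ (fundamentalForm J) -
        fundamentalForm J ⋏ ((2 : ℂ) • dualForm (θ ∘ₗ J.map))) ![X, Y, Z] =
          ((3 * T₁ X Y Z : ℝ) : ℂ) := fun X Y Z ↦ by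
      rw [AlternatingMap.sub_apply, h.fundamentalForm_wedge_apply, extDeriv₂_fundamentalForm_apply,
        ← hsum, ← cyclicSum_of_W₁ h1]
      have e2 := h2.2 X Y Z
      have e4 := cyclicSum_of_W₄ h4 X Y Z
      simp only [LinearMap.add_apply, AlternatingMap.smul_apply, dualForm_apply,
        LinearMap.comp_apply, smul_eq_mul]
      norm_cast
      linear_combination e2 + e4
    have hmem : extDeriv₂ (fundamentalForm J) -
        fundamentalForm J ⋏ ((2 : ℂ) • dualForm (θ ∘ₗ J.map)) ∈ skewTypeForms J := fun X Y Z ↦ by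
      rw [hψ, hψ, h1.1.2]
      push_cast
      ring
    rw [← sub_add_cancel (extDeriv₂ (fundamentalForm J))
      (fundamentalForm J ⋏ ((2 : ℂ) • dualForm (θ ∘ₗ J.map)))]
    exact Submodule.add_mem_sup (h.mem_sup_of_mem_skewTypeForms hdim hmem)
      (Submodule.subset_span ⟨_, rfl⟩)
  · intro hd
    obtain ⟨ψ, hψ, χ, hχ, hsum⟩ := Submodule.mem_sup.1 hd
    have hω : omegaWedge J ≤ LinearMap.range (wedgeBilin 2 1 (fundamentalForm J)) := by
      refine Submodule.span_le.2 ?_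
      rintro _ ⟨a, rfl⟩
      exact ⟨a, rfl⟩
    obtain ⟨a, rfl⟩ := hω hχ
    rw [wedgeBilin_apply] at hsum
    -- The forms `ψ` and `a` may be complex; as $d\omega$ and $\omega$ are real, their real parts
    -- suffice. The factor $1/3$ undoes the tripling by the cyclic sum.
    obtain ⟨T₁, h1, hT₁⟩ : ∃ T₁ ∈ W₁ J, ∀ X Y Z, T₁ X Y Z = 1 / 3 * (ψ ![X, Y, Z]).re :=
      ⟨(1 / 3 : ℝ) • reTensor ψ,
        (W₁ J).smul_mem _ (reTensor_mem_W₁ (sup_le_skewTypeForms hψ)), fun _ _ _ ↦ rfl⟩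
    -- Chosen so that $2\,\theta\circ J=\operatorname{Re}a$; the minus sign comes from $J^2=-1$.
    let θ : Module.Dual ℝ L := (-1 / 2 : ℝ) • (Complex.reLm ∘ₗ oneFormLin a ∘ₗ J.map)
    have hθ : ∀ X, θ (J.map X) = 1 / 2 * (a ![X]).re := fun X ↦ by
      change (-1 / 2 : ℝ) * (oneFormLin a (J.map (J.map X))).re = _
      rw [J.sq, map_neg, oneFormLin_apply, Complex.neg_re]
      ring
    have h4 := w₄Tensor_mem (J := J) θ
    refine mem_sup_of_cyclicSum_eq (nablaOmega_mem_grayHervellaSpace J) h1 h4 fun X Y Z ↦ ?_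
    have e1 := cyclicSum_of_W₁ h1 X Y Z
    have e4 := cyclicSum_of_W₄ (w₄Tensor_apply (J := J) θ) X Y Z
    have e0 := congrArg Complex.re (DFunLike.congr_fun hsum ![X, Y, Z])
    rw [extDeriv₂_fundamentalForm_apply, AlternatingMap.add_apply,
      h.fundamentalForm_wedge_apply, Complex.ofReal_re] at e0
    simp only [Complex.add_re, Complex.sub_re, Complex.re_ofReal_mul] at e0
    have e3 := hT₁ X Y Z
    simp only [hθ] at e4
    linear_combination -e0 - e1 - e4 - 3 * e3

end LieAlgebra

end AlmostHermitian

end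

/-! ### The theorem -/

theorem lemma3 {L : Type*} [LieRing L] [LieAlgebra ℝ L] [FiniteDimensional ℝ L]
    (hdim : Module.finrank ℝ L = 6) (g : InvariantMetric L) (J : OrthogonalACS g)
    (α β γ : Form L 1) (hcof : IsUnitaryCoframe J α β γ) :
    -- the class is characterised by the six equations
    (J ∈ Z124 g ↔ ∀ i, extDeriv₂ (fundamentalForm J) ⋏ eta α β γ i = 0) ∧
    -- the six forms are a basis of the effective (2,1)-forms
    LinearIndependent ℂ (eta α β γ) ∧
    (∀ φ : Form L 3,
      φ ∈ Submodule.span ℂ (Set.range (eta α β γ)) ↔ IsEffective21 J φ) ∧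
    -- wedging with the i-th form extracts the component of dω along its conjugate
    ∃ ρ ∈ lambda30 J ⊔ lambda03 J ⊔ omegaWedge J, ∃ c : Fin 6 → ℂ,
      extDeriv₂ (fundamentalForm J) =
        ρ + ∑ i, (c i • conjForm (eta α β γ i) + (starRingEnd ℂ) (c i) • eta α β γ i) ∧
      ∀ i,
        extDeriv₂ (fundamentalForm J) ⋏ eta α β γ i =
          c i • (conjForm (eta α β γ i) ⋏ eta α β γ i) ∧
        conjForm (eta α β γ i) ⋏ eta α β γ i ≠ 0 := by
  obtain ⟨ρ, hρ, c, hc⟩ := hcof.exists_eq_add_sum hdim (conjForm_extDeriv₂_fundamentalForm J)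
  have hw : ∀ i, extDeriv₂ (fundamentalForm J) ⋏ eta α β γ i =
      c i • (conjForm (eta α β γ i) ⋏ eta α β γ i) := fun i ↦ by
    rw [hc]; exact hcof.add_sum_wedge_eta hdim hρ c i
  refine ⟨?_, hcof.linearIndependent_eta hdim, hcof.mem_span_eta_iff hdim, ρ, hρ, c, hc,
    fun i ↦ ⟨hw i, hcof.conj_eta_wedge_eta_ne_zero hdim i⟩⟩
  rw [hcof.mem_Z124_iff hdim]
  refine ⟨fun hd i ↦ hcof.wedge_eta_eq_zero hdim hd i, fun hd ↦ ?_⟩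
  -- Vanishing of all six products kills every effective coefficient, so $d\omega=\rho$ is
  -- non-effective.
  have hc0 : ∀ i, c i = 0 := fun i ↦
    (smul_eq_zero.1 ((hw i).symm.trans (hd i))).resolve_right
      (hcof.conj_eta_wedge_eta_ne_zero hdim i)
  rw [hc]
  simpa [hc0] using hρ
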